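/- An \emph{eQDAS} (queue-dispatch asynchronous system extended by fork/join) consists of a finite data domain $D$ with an initial value $d_0$, a finite set of concurrent FIFO queues (there are no serial queues and no synchronous dispatches), a finite set $X$ of $D$-valued global variables, and a finite set $\Gamma$ of blocks with a distinguished block $main$. Each block $\gamma$ is a finite transition system with pairwise disjoint state sets $S_\gamma$, an initial state $s^0_\gamma$, and a distinct final state $f_\gamma$, whose transitions are labelled by actions of the following forms: an asynchronous dispatch $\mathrm{dispatch}_a(q,\gamma')$ of a block $\gamma'\neq main$ to a queue $q$; $\mathrm{forkjoin}(q,\gamma',p)$ with a queue $q$, a block $\gamma'$ and a parameter $p\in\mathbb N\cup\{\ast\}$; a guard, i.e. a finite conjunction of atoms $x=d$ or $x\ne d$; or an assignment $x\gets d$. Let $S=\biguplus_\gamma S_\gamma$ be the set of locations. A configuration consists of a valuation of $X$ and a finite directed graph (call-task graph) whose vertices are either \emph{calls} (blocks waiting in a queue) or \emph{tasks} (running blocks), each labelled by its block, its queue and its current location (for calls, the initial state of the block). Each call has an edge to its predecessor in its queue, if there is one; all other edges are \emph{wait} edges. A vertex is unblocked if it has no outgoing edge. Initially there is a single task, which runs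 $main$ from $s^0_{main}$, no edge, and every variable has value $d_0$. An unblocked task at location $s$ may take a transition $(s,a,s')$ and move to $s'$: a guard must hold; an assignment updates the valuation; $\mathrm{dispatch}_a(q,\gamma')$ appends a new call of $\gamma'$ to the tail of $q$; $\mathrm{forkjoin}(q,\gamma',p)$ appends $n$ new calls of $\gamma'$ to the tail of $q$, one after the other, and adds a wait edge from the task to each of them, where $n=p$ if $p\in\mathbb N$ and $n\in\mathbb N$ is chosen nondeterministically if $p=\ast$. Moreover, the scheduler may at any time turn the call at the head of a queue into a task (its incoming queue edge disappears, incoming wait edges remain), or delete, with all its incoming edges, an unblocked task that is in the final state of its block. A run is a sequence of such steps from the initial configuration. The \emph{extended Parikh coverability problem} asks, given an eQDAS and a function $f:S\to\mathbb N$, whether some reachable configuration has, for every $s\in S$, at least $f(s)$ vertices (calls and tasks) at location $s$. The \emph{extended termination problem} asks, given an eQDAS, whether it has no infinite run. \textbf{Theorem.} Both the extended Parikh coverability problem and the extended termination problem are undecidable. -/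

import Mathlib

namespace QueueDispatch

/-! ### Syntax

All finite sets of a system are initial segments of `ℕ`, so that a system is a finite object
that can be handed to an algorithm: the data domain is `{0, …, dataSize - 1}`, the concurrent
queues are `{0, …, numQueues - 1}`, the variables are `{0, …, numVars - 1}`, the blocks are
`{0, …, blocks.length - 1}`, and the states of a block are `{0, …, numStates - 1}`.
There are no serial queues in an extended system. -/

/-- Atoms `x = d` and `x ≠ d`. -/
inductive Atom where
  | eq (x d : ℕ)
  | ne (x d : ℕ)

/-- The actions of a queue-dispatch asynchronous system extended by fork/join. A guard is a finite
conjunction of atoms. The parameter `some n` of a fork/join action is the number `n`, and the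
parameter `none` is `∗`. -/
inductive Action where
  | dispatchAsync (q γ : ℕ)
  | forkjoin (q γ : ℕ) (p : Option ℕ)
  | guard (g : List Atom)
  | assign (x d : ℕ)

/-- A block: a finite labelled transition system with an initial and a final state. -/
structure Block where
  numStates : ℕ
  init : ℕ
  final : ℕ
  trans : List (ℕ × Action × ℕ)

/-- The data of a queue-dispatch asynchronous system extended by fork/join (eQDAS). -/
structure EQdas where
  dataSize : ℕ
  initialValue : ℕ
  numQueues : ℕ
  numVars : ℕ
  main : ℕ
  blocks : List Block

/-- All identifiers in the atom exist. -/
def Atom.Valid (A : EQdas) : Atom → Prop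
  | .eq x d => x < A.numVars ∧ d < A.dataSize
  | .ne x d => x < A.numVars ∧ d < A.dataSize

/-- The action belongs to the alphabet `Σ` of the system. -/
def Action.Valid (A : EQdas) : Action → Prop
  | .dispatchAsync q γ => q < A.numQueues ∧ γ < A.blocks.length ∧ γ ≠ A.main
  | .forkjoin q γ _ => q < A.numQueues ∧ γ < A.blocks.length
  | .guard g => ∀ t ∈ g, t.Valid A
  | .assign x d => x < A.numVars ∧ d < A.dataSize

/-- The block is a labelled transition system over `Σ` with a final state that is distinct from
the initial one. -/
def Block.Valid (A : EQdas) (B : Block) : Prop :=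
  B.init < B.numStates ∧ B.final < B.numStates ∧ B.init ≠ B.final ∧
    ∀ t ∈ B.trans, t.1 < B.numStates ∧ t.2.1.Valid A ∧ t.2.2 < B.numStates

/-- The data describe an eQDAS. -/
def EQdas.Valid (A : EQdas) : Prop :=
  A.initialValue < A.dataSize ∧ A.main < A.blocks.length ∧ ∀ B ∈ A.blocks, B.Valid A

/-! ### Systems as inputs of algorithms -/

def atomEquiv : Atom ≃ (ℕ × ℕ) ⊕ (ℕ × ℕ) where
  toFun
    | .eq x d => .inl (x, d)
    | .ne x d => .inr (x, d)
  invFun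
    | .inl (x, d) => .eq x d
    | .inr (x, d) => .ne x d
  left_inv t := by cases t <;> rfl
  right_inv t := by rcases t with ⟨x, d⟩ | ⟨x, d⟩ <;> rfl

instance : Primcodable Atom := Primcodable.ofEquiv _ atomEquiv

def actionEquiv :
    Action ≃ (ℕ × ℕ) ⊕ ((ℕ × ℕ × Option ℕ) ⊕ (List Atom ⊕ (ℕ × ℕ))) where
  toFun
    | .dispatchAsync q γ => .inl (q, γ)
    | .forkjoin q γ p => .inr (.inl (q, γ, p))
    | .guard g => .inr (.inr (.inl g))
    | .assign x d => .inr (.inr (.inr (x, d)))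
  invFun
    | .inl (q, γ) => .dispatchAsync q γ
    | .inr (.inl (q, γ, p)) => .forkjoin q γ p
    | .inr (.inr (.inl g)) => .guard g
    | .inr (.inr (.inr (x, d))) => .assign x d
  left_inv t := by cases t <;> rfl
  right_inv t := by rcases t with ⟨q, γ⟩ | ⟨q, γ, p⟩ | g | ⟨x, d⟩ <;> rfl

instance : Primcodable Action := Primcodable.ofEquiv _ actionEquiv

def blockEquiv : Block ≃ ℕ × ℕ × ℕ × List (ℕ × Action × ℕ) where
  toFun B := (B.numStates, B.init, B.final, B.trans)
  invFun t := ⟨t.1, t.2.1, t.2.2.1, t.2.2.2⟩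
  left_inv _ := rfl
  right_inv _ := rfl

instance : Primcodable Block := Primcodable.ofEquiv _ blockEquiv

def eqdasEquiv : EQdas ≃ ℕ × ℕ × ℕ × ℕ × ℕ × List Block where
  toFun A := (A.dataSize, A.initialValue, A.numQueues, A.numVars, A.main, A.blocks)
  invFun t := ⟨t.1, t.2.1, t.2.2.1, t.2.2.2.1, t.2.2.2.2.1, t.2.2.2.2.2⟩
  left_inv _ := rfl
  right_inv _ := rfl

instance : Primcodable EQdas := Primcodable.ofEquiv _ eqdasEquiv

/-! ### Locations and transitions -/

/-- A location is a pair of a block and one of its states; the pairing makes the sets of states of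
the blocks disjoint. -/
abbrev Loc := ℕ × ℕ

namespace EQdas

/-- The block with a given identifier (arbitrary if there is no such block). -/
def block (A : EQdas) (γ : ℕ) : Block := A.blocks.getD γ ⟨0, 0, 0, []⟩

/-- The set `S` of all locations. -/
def locs (A : EQdas) : Set Loc := {s | s.1 < A.blocks.length ∧ s.2 < (A.block s.1).numStates}

def initLoc (A : EQdas) (γ : ℕ) : Loc := (γ, (A.block γ).init)

def finalLoc (A : EQdas) (γ : ℕ) : Loc := (γ, (A.block γ).final)

/-- The union `Δ` of the transition relations of all blocks. -/
def Delta (A : EQdas) : Set (Loc × Action × Loc) :=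
  {δ | ∃ γ s a s', γ < A.blocks.length ∧ (s, a, s') ∈ (A.block γ).trans ∧
    δ = ((γ, s), a, (γ, s'))}

end EQdas

/-! ### Call-task graphs -/

/-- A call-task graph. Only the labels of the vertices in `verts` matter. The call vertices are the
`v ∈ verts` with `isCall v = true`, the other elements of `verts` are the task vertices. The queue
label `none` is the extra identifier `ι` of the initial task. -/
structure Ctg where
  verts : Finset ℕ
  isCall : ℕ → Bool
  edges : Set (ℕ × ℕ)
  block : ℕ → ℕ
  queue : ℕ → Option ℕ
  state : ℕ → Loc

namespace Ctg

/-- `v` is a call vertex held by the queue `q`. -/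
def IsCallOf (G : Ctg) (q v : ℕ) : Prop :=
  v ∈ G.verts ∧ G.isCall v = true ∧ G.queue v = some q

def IsTask (G : Ctg) (v : ℕ) : Prop := v ∈ G.verts ∧ G.isCall v = false

/-- The queue edges of `q`: the edges between call vertices held by `q`. All edges that are not
queue edges of some queue are wait edges. -/
def QueueEdge (G : Ctg) (q u v : ℕ) : Prop :=
  (u, v) ∈ G.edges ∧ G.IsCallOf q u ∧ G.IsCallOf q v

/-- The head of a queue: no outgoing queue edge. -/
def IsHead (G : Ctg) (q v : ℕ) : Prop := G.IsCallOf q v ∧ ∀ u, ¬ G.QueueEdge q v u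

/-- The tail of a queue: no incoming queue edge. -/
def IsTail (G : Ctg) (q v : ℕ) : Prop := G.IsCallOf q v ∧ ∀ u, ¬ G.QueueEdge q u v

/-- A vertex is unblocked if it has no outgoing edge. -/
def Unblocked (G : Ctg) (v : ℕ) : Prop := ∀ u, (v, u) ∉ G.edges

/-- The Parikh image: the number of vertices (call or task) at each location. -/
def parikh (G : Ctg) (s : Loc) : ℕ := (G.verts.filter fun v => G.state v = s).card

/-- `G ∖ v`. -/
def remove (G : Ctg) (v : ℕ) : Ctg :=
  { G with
    verts := G.verts.erase v
    edges := {e | e ∈ G.edges ∧ e.1 ≠ v ∧ e.2 ≠ v} }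

/-- Insert a call of the block `γ`, as the new vertex `v`, at the tail of the queue `q`. -/
def enqueue (A : EQdas) (G : Ctg) (q γ v : ℕ) : Ctg where
  verts := insert v G.verts
  isCall := Function.update G.isCall v true
  edges := G.edges ∪ {e | e.1 = v ∧ G.IsTail q e.2}
  block := Function.update G.block v γ
  queue := Function.update G.queue v (some q)
  state := Function.update G.state v (A.initLoc γ)

/-- Turn the head `h` of the queue `q` into a task vertex. The queue edge into `h` disappears, wait
edges are kept. -/
def dequeue (G : Ctg) (q h : ℕ) : Ctg :=
  { G with
    isCall := Function.update G.isCall h false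
    edges := {e | e ∈ G.edges ∧ ¬ (e.2 = h ∧ G.QueueEdge q e.1 e.2)} }

/-- Change the state of the vertex `v`. -/
def setState (G : Ctg) (v : ℕ) (s : Loc) : Ctg :=
  { G with state := Function.update G.state v s }

/-- The task `v` fires the transition `δ` in `G` and the result is `G'`. -/
def StepBy (G : Ctg) (δ : Loc × Action × Loc) (v : ℕ) (G' : Ctg) : Prop :=
  G.IsTask v ∧ G.Unblocked v ∧ G.state v = δ.1 ∧ G' = G.setState v δ.2.2

/-- Add a wait edge from `v` to `v'`. -/
def letwait (G : Ctg) (v v' : ℕ) : Ctg := { G with edges := G.edges ∪ {(v, v')} }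

/-- `Fork A q γ v n G G'`: `G'` results from `G` by appending `n` calls of `γ` to the queue `q`, one
after the other, each of them as a fresh vertex with a wait edge from `v`. -/
inductive Fork (A : EQdas) (q γ v : ℕ) : ℕ → Ctg → Ctg → Prop
  | zero (G : Ctg) : Fork A q γ v 0 G G
  | succ {n : ℕ} {G G' : Ctg} (v' : ℕ) : Fork A q γ v n G G' → v' ∉ G'.verts →
      Fork A q γ v (n + 1) G ((G'.enqueue A q γ v').letwait v v')

/-- A final vertex: an unblocked task in the final state of its block. -/
def IsFinal (A : EQdas) (G : Ctg) (v : ℕ) : Prop :=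
  G.IsTask v ∧ G.Unblocked v ∧ G.state v = A.finalLoc (G.block v)

end Ctg

/-! ### Semantics -/

def Atom.Holds (d : ℕ → ℕ) : Atom → Prop
  | .eq x e => d x = e
  | .ne x e => d x ≠ e

/-- A configuration: a call-task graph and a valuation (of which only the values of the variables
of the system matter). -/
structure Config where
  graph : Ctg
  val : ℕ → ℕ

namespace EQdas

/-- The initial configuration: one task that runs the block `main`, and all variables have the
initial value. -/
def initConfig (A : EQdas) : Config where
  graph :=
    { verts := {0}
      isCall := fun _ => false
      edges := ∅
      block := fun _ => A.main
      queue := fun _ => none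
      state := fun _ => A.initLoc A.main }
  val := fun _ => A.initialValue

/-- The labelled transition relation; the label `none` is the scheduler action `ε`. -/
inductive Trans (A : EQdas) : Config → Option Action → Config → Prop
  | dispatchAsync {G G' : Ctg} {d : ℕ → ℕ} {s s' : Loc} {q γ v : ℕ} (v' : ℕ) :
      (s, Action.dispatchAsync q γ, s') ∈ A.Delta →
      G.StepBy (s, Action.dispatchAsync q γ, s') v G' →
      v' ∉ G'.verts →
      Trans A ⟨G, d⟩ (some (.dispatchAsync q γ)) ⟨G'.enqueue A q γ v', d⟩
  | forkjoin {G G' G'' : Ctg} {d : ℕ → ℕ} {s s' : Loc} {q γ v : ℕ} {p : Option ℕ} (n : ℕ) :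
      (s, Action.forkjoin q γ p, s') ∈ A.Delta →
      G.StepBy (s, Action.forkjoin q γ p, s') v G' →
      (p = none ∨ p = some n) →
      Ctg.Fork A q γ v n G' G'' →
      Trans A ⟨G, d⟩ (some (.forkjoin q γ p)) ⟨G'', d⟩
  | guard {G G' : Ctg} {d : ℕ → ℕ} {s s' : Loc} {g : List Atom} {v : ℕ} :
      (s, Action.guard g, s') ∈ A.Delta →
      (∀ t ∈ g, t.Holds d) →
      G.StepBy (s, Action.guard g, s') v G' →
      Trans A ⟨G, d⟩ (some (.guard g)) ⟨G', d⟩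
  | assign {G G' : Ctg} {d : ℕ → ℕ} {s s' : Loc} {x e v : ℕ} :
      (s, Action.assign x e, s') ∈ A.Delta →
      G.StepBy (s, Action.assign x e, s') v G' →
      Trans A ⟨G, d⟩ (some (.assign x e)) ⟨G', Function.update d x e⟩
  | terminate {G : Ctg} {d : ℕ → ℕ} {v : ℕ} :
      G.IsFinal A v →
      Trans A ⟨G, d⟩ none ⟨G.remove v, d⟩
  | schedule {G : Ctg} {d : ℕ → ℕ} {q h : ℕ} :
      q < A.numQueues → G.IsHead q h → G.Unblocked h →
      Trans A ⟨G, d⟩ none ⟨G.dequeue q h, d⟩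

/-- The configuration is reached by a finite run. -/
def Reachable (A : EQdas) (c : Config) : Prop :=
  Relation.ReflTransGen (fun c₁ c₂ => ∃ a, A.Trans c₁ a c₂) A.initConfig c

/-- `f` is Parikh-coverable: some reachable configuration has, at every location `s`, at least
`f s` vertices. -/
def ParikhCoverable (A : EQdas) (f : Loc → ℕ) : Prop :=
  ∃ c, A.Reachable c ∧ ∀ s ∈ A.locs, f s ≤ c.graph.parikh s

/-- There is no infinite run. -/
def Terminates (A : EQdas) : Prop :=
  ¬ ∃ (c : ℕ → Config) (a : ℕ → Option Action),
    c 0 = A.initConfig ∧ ∀ i, A.Trans (c i) (a i) (c (i + 1))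

end EQdas

/-! ### Decision problems -/

/-- A mapping from locations to `ℕ` as a table: the entry number `s` in row number `γ` is the value
at the location `(γ, s)`; missing entries are `0`. -/
def tableMap (T : List (List ℕ)) (s : Loc) : ℕ := (T.getD s.1 []).getD s.2 0

/-- Some algorithm answers the question `P` correctly for every instance, where an instance is an
input that satisfies `inst`. -/
def DecidableProblem {α : Type} [Primcodable α] (inst P : α → Prop) : Prop :=
  ∃ alg : α → Bool, Computable alg ∧ ∀ x, inst x → (alg x = true ↔ P x)

/-- The extended Parikh coverability problem is decidable. -/
def ExtendedParikhCoverabilityDecidable : Prop :=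
  DecidableProblem (fun x : EQdas × List (List ℕ) => x.1.Valid)
    (fun x => x.1.ParikhCoverable (tableMap x.2))

/-- The extended termination problem is decidable. -/
def ExtendedTerminationDecidable : Prop :=
  DecidableProblem EQdas.Valid EQdas.Terminates

end QueueDispatch

/-! ### Multi-stack machines with finite control -/

namespace QueueDispatch

/-! Fork/join with parameter 1 turns a chain of waiting tasks into a stack: only the newest task is
unblocked, forking a child pushes a symbol, and termination of the newest task pops its symbol and
releases its parent. With one such chain per stack and the control state in a single global
variable, an eQDAS simulates a multi-stack machine. Among the tasks that hold symbols, only the top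
of the stack which the current control state inspects can pass its guard, so concurrency only
interleaves bookkeeping with a deterministic computation.

This is made precise by the invariant `Inv`. By `Inv.advances`, every step of the system either
performs the next machine step or represents the same machine configuration with a smaller `rank`.
By `Inv.enabled`, the system is not stuck before the machine has halted and the main task has
noticed it. Hence all runs are finite exactly if the machine halts (`WF.terminates_iff`), and the
location of the main task that signals halting is coverable exactly if the machine halts
(`WF.parikhCoverable_iff`).

It remains to supply machines with undecidable halting. For a fixed partial recursive function, the
machine of `Turing.PartrecToTM2` uses finitely many labels and so becomes a finite table; only a
prefix of control states that loads the input depends on the argument. The resulting map from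
arguments to systems is primitive recursive (`exists_halts_iff`), and both problems inherit the
undecidability of halting. -/

/-- A deterministic machine with `numStk` stacks and finite control. A stack symbol `γ` belongs to
the stack `γ % numStk`; the symbols below `numStk` mark the bottoms of the stacks. In the control
state `q ≠ 0` with the symbol `γ` on top of the stack `stk q`, the machine goes to `nxt q γ` and
keeps the stack if `act q γ = 0`, pops if `act q γ = 1`, and pushes `γ'` if `act q γ = γ' + 2`. It
halts in the control state `0`. -/
structure StackMachine where
  numStk : ℕ
  numSym : ℕ
  numCtl : ℕ
  start : ℕ
  stk : ℕ → ℕ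
  nxt : ℕ → ℕ → ℕ
  act : ℕ → ℕ → ℕ

namespace StackMachine

/-- Bottom markers can never be popped, and a pushed symbol belongs to the stack it is pushed to.
Only the first condition keeps stacks, and later chains of tasks, nonempty. -/
structure WF (M : StackMachine) : Prop where
  numStk_pos : 0 < M.numStk
  numStk_le : M.numStk ≤ M.numSym
  start_lt : M.start < M.numCtl
  stk_lt : ∀ q < M.numCtl, M.stk q < M.numStk
  nxt_lt : ∀ q < M.numCtl, ∀ γ < M.numSym, M.nxt q γ < M.numCtl
  act_ok : ∀ q < M.numCtl, ∀ γ < M.numSym, γ % M.numStk = M.stk q →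
    M.act q γ = 0 ∨ (M.act q γ = 1 ∧ M.numStk ≤ γ) ∨
      ∃ γ' < M.numSym, M.act q γ = γ' + 2 ∧ γ' % M.numStk = γ % M.numStk

/-- The effect of an action on a stack with top `γ`. -/
def applyAct (t γ : ℕ) (l : List ℕ) : List ℕ :=
  match t with
  | 0 => γ :: l
  | 1 => l
  | t + 2 => t :: γ :: l

/-- A configuration of a machine: control state and stacks (top first). -/
abbrev Cfg := ℕ × (ℕ → List ℕ)

def step (M : StackMachine) (m : Cfg) : Option Cfg :=
  if m.1 = 0 then none
  else
    match m.2 (M.stk m.1) with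
    | [] => none
    | γ :: l =>
      some (M.nxt m.1 γ, Function.update m.2 (M.stk m.1) (applyAct (M.act m.1 γ) γ l))

def initCfg (M : StackMachine) : Cfg := (M.start, fun k => [k])

structure Good (M : StackMachine) (m : Cfg) : Prop where
  ctl : m.1 < M.numCtl
  bot : ∀ k < M.numStk, ∃ l, m.2 k = l ++ [k]
  sym : ∀ k < M.numStk, ∀ γ ∈ m.2 k, γ < M.numSym ∧ γ % M.numStk = k

theorem WF.good_init {M : StackMachine} (h : M.WF) : M.Good M.initCfg where
  ctl := h.start_lt
  bot k _ := ⟨[], rfl⟩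
  sym k hk γ hγ := by
    simp only [initCfg, List.mem_singleton] at hγ
    subst hγ
    exact ⟨hk.trans_le h.numStk_le, Nat.mod_eq_of_lt hk⟩

theorem step_eq_some {M : StackMachine} {m : Cfg} {γ : ℕ} {l : List ℕ} (h0 : m.1 ≠ 0)
    (h : m.2 (M.stk m.1) = γ :: l) :
    M.step m = some (M.nxt m.1 γ,
      Function.update m.2 (M.stk m.1) (applyAct (M.act m.1 γ) γ l)) := by
  simp [step, h0, h]

theorem WF.good_step {M : StackMachine} (h : M.WF) {m m' : Cfg} (hm : M.Good m)
    (hs : M.step m = some m') : M.Good m' := by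
  by_cases h0 : m.1 = 0
  · simp [step, h0] at hs
  have hk := h.stk_lt _ hm.ctl
  obtain ⟨r, hr⟩ := hm.bot _ hk
  rcases hl : m.2 (M.stk m.1) with - | ⟨γ, l⟩
  · simp [hl] at hr
  rw [step_eq_some h0 hl, Option.some_inj] at hs
  subst hs
  have hsym := hm.sym _ hk
  rw [hl] at hsym hr
  have hγ := hsym γ (by simp)
  have hact := h.act_ok _ hm.ctl γ hγ.1 hγ.2
  refine ⟨h.nxt_lt _ hm.ctl _ hγ.1, fun k hk' => ?_, fun k hk' => ?_⟩
  · by_cases hkk : k = M.stk m.1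
    · subst hkk
      simp only [Function.update_self]
      rcases hact with e | ⟨e, hge⟩ | ⟨γ', -, e, -⟩
      · exact ⟨r, by rw [e]; exact hr⟩
      · rw [e]
        -- If nothing lay above the bottom, the popped symbol would be the bottom marker, which
        -- `hge` excludes.
        rcases r with - | ⟨a, r⟩
        · simp only [List.nil_append, List.cons.injEq] at hr
          omega
        · exact ⟨r, by simpa [applyAct] using (List.cons.inj hr).2⟩
      · exact ⟨γ' :: r, by rw [e]; simp [applyAct, hr]⟩
    · simpa [hkk] using hm.bot k hk'
  · by_cases hkk : k = M.stk m.1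
    · subst hkk
      simp only [Function.update_self]
      rcases hact with e | ⟨e, hge⟩ | ⟨γ', hγ', e, e'⟩
      · rw [e]; exact hsym
      · rw [e]; exact fun x hx => hsym x (List.mem_cons_of_mem _ hx)
      · rw [e]
        intro x hx
        rcases List.mem_cons.1 hx with rfl | hx
        · exact ⟨hγ', e'.trans hγ.2⟩
        · exact hsym x hx
    · simpa [hkk] using hm.sym k hk'

theorem Good.step_ne_none {M : StackMachine} (h : M.WF) {m : Cfg} (hm : M.Good m)
    (h0 : m.1 ≠ 0) : ∃ m', M.step m = some m' := by
  obtain ⟨r, hr⟩ := hm.bot _ (h.stk_lt _ hm.ctl)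
  rcases hl : m.2 (M.stk m.1) with - | ⟨γ, l⟩
  · simp [hl] at hr
  · exact ⟨_, step_eq_some h0 hl⟩

/-! ### The system of a stack machine -/

/-- The transitions of the task that holds the symbol `γ` for the control state `q`. -/
def ctlTrans (M : StackMachine) (γ q : ℕ) : List (ℕ × Action × ℕ) :=
  if q ≠ 0 ∧ γ % M.numStk = M.stk q then
    [(0, .guard [.eq 0 q], q + (M.numSym + 2)),
      (q + (M.numSym + 2), .assign 0 (M.nxt q γ), M.act q γ)]
  else []

/-- The block of a task that holds the symbol `γ`. In state `0` it waits for its turn, `1` is the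
final state, in state `γ' + 2` it is about to push `γ'`, and in state `q + (numSym + 2)` it has
seen the control state `q`. -/
def symBlock (M : StackMachine) (γ : ℕ) : Block where
  numStates := M.numCtl + (M.numSym + 2)
  init := 0
  final := 1
  trans := (List.range M.numCtl).flatMap (M.ctlTrans γ) ++
    (List.range M.numSym).map fun γ' => (γ' + 2, .forkjoin (γ % M.numStk) γ' (some 1), 0)

/-- The main block dispatches the bottoms of the stacks and then waits for the machine to halt. -/
def mainBlock (M : StackMachine) : Block where
  numStates := M.numStk + 3
  init := 0
  final := M.numStk + 2
  trans := (List.range M.numStk).map (fun i => (i, .dispatchAsync i i, i + 1)) ++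
    [(M.numStk, .guard [.eq 0 0], M.numStk + 1)]

/-- The only variable holds the control state. The values of `act` are chosen to be states of
`symBlock`, so the assignment of the next control state can send the task directly to the state that
keeps, pops or pushes. -/
def sys (M : StackMachine) : EQdas where
  dataSize := M.numCtl
  initialValue := M.start
  numQueues := M.numStk
  numVars := 1
  main := M.numSym
  blocks := (List.range M.numSym).map M.symBlock ++ [M.mainBlock]

theorem sys_block_sym (M : StackMachine) {γ : ℕ} (h : γ < M.numSym) :
    M.sys.block γ = M.symBlock γ := by
  simp [EQdas.block, sys, List.getElem?_append_left, h]

theorem sys_block_main (M : StackMachine) : M.sys.block M.numSym = M.mainBlock := by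
  simp [EQdas.block, sys]

theorem sys_length (M : StackMachine) : M.sys.blocks.length = M.numSym + 1 := by simp [sys]

theorem mem_symBlock_trans {M : StackMachine} {γ : ℕ} {t : ℕ × Action × ℕ} :
    t ∈ (M.symBlock γ).trans ↔
      (∃ q < M.numCtl, (q ≠ 0 ∧ γ % M.numStk = M.stk q) ∧
        (t = (0, .guard [.eq 0 q], q + (M.numSym + 2)) ∨
          t = (q + (M.numSym + 2), .assign 0 (M.nxt q γ), M.act q γ))) ∨
      ∃ γ' < M.numSym, t = (γ' + 2, .forkjoin (γ % M.numStk) γ' (some 1), 0) := by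
  simp only [symBlock, List.mem_append, List.mem_flatMap, List.mem_range, List.mem_map, ctlTrans]
  refine or_congr (exists_congr fun q => and_congr_right fun _ => ?_)
    (exists_congr fun q => and_congr_right fun _ => eq_comm)
  split_ifs with h <;> simp [h]

theorem mem_mainBlock_trans {M : StackMachine} {t : ℕ × Action × ℕ} :
    t ∈ M.mainBlock.trans ↔
      (∃ i < M.numStk, t = (i, .dispatchAsync i i, i + 1)) ∨
        t = (M.numStk, .guard [.eq 0 0], M.numStk + 1) := by
  simp [mainBlock, eq_comm]

theorem mem_delta {M : StackMachine} {δ : Loc × Action × Loc} :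
    δ ∈ M.sys.Delta ↔
      ((∃ i < M.numStk, δ = ((M.numSym, i), .dispatchAsync i i, (M.numSym, i + 1))) ∨
        δ = ((M.numSym, M.numStk), .guard [.eq 0 0], (M.numSym, M.numStk + 1))) ∨
      ∃ γ < M.numSym,
        (∃ q < M.numCtl, (q ≠ 0 ∧ γ % M.numStk = M.stk q) ∧
          (δ = ((γ, 0), .guard [.eq 0 q], (γ, q + (M.numSym + 2))) ∨
            δ = ((γ, q + (M.numSym + 2)), .assign 0 (M.nxt q γ), (γ, M.act q γ)))) ∨
        ∃ γ' < M.numSym, δ = ((γ, γ' + 2), .forkjoin (γ % M.numStk) γ' (some 1), (γ, 0)) := by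
  constructor
  · rintro ⟨γ, s, a, s', hγ, ht, rfl⟩
    rw [sys_length] at hγ
    rcases Nat.lt_succ_iff_lt_or_eq.1 hγ with h | rfl
    · rw [sys_block_sym M h, mem_symBlock_trans] at ht
      refine .inr ⟨γ, h, ?_⟩
      simpa only [Prod.mk.injEq, true_and] using ht
    · rw [sys_block_main, mem_mainBlock_trans] at ht
      refine .inl ?_
      simpa only [Prod.mk.injEq, true_and] using ht
  · rintro (h | ⟨γ, hγ, h⟩)
    · have key : ∀ s a s', (s, a, s') ∈ M.mainBlock.trans →
          ((M.numSym, s), a, (M.numSym, s')) ∈ M.sys.Delta := fun s a s' ht =>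
        ⟨M.numSym, s, a, s', by simp [sys_length], by rwa [sys_block_main], rfl⟩
      rcases h with ⟨i, hi, rfl⟩ | rfl
      · exact key _ _ _ (mem_mainBlock_trans.2 (.inl ⟨i, hi, rfl⟩))
      · exact key _ _ _ (mem_mainBlock_trans.2 (.inr rfl))
    · have key : ∀ s a s', (s, a, s') ∈ (M.symBlock γ).trans →
          ((γ, s), a, (γ, s')) ∈ M.sys.Delta := fun s a s' ht =>
        ⟨γ, s, a, s', by rw [sys_length]; omega, by rwa [sys_block_sym M hγ], rfl⟩
      rcases h with ⟨q, hq, hq', rfl | rfl⟩ | ⟨γ', hγ', rfl⟩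
      · exact key _ _ _ (mem_symBlock_trans.2 (.inl ⟨q, hq, hq', .inl rfl⟩))
      · exact key _ _ _ (mem_symBlock_trans.2 (.inl ⟨q, hq, hq', .inr rfl⟩))
      · exact key _ _ _ (mem_symBlock_trans.2 (.inr ⟨γ', hγ', rfl⟩))

theorem WF.sys_valid {M : StackMachine} (h : M.WF) : M.sys.Valid := by
  have hlen := M.sys_length
  have hN : 0 < M.numCtl := (Nat.zero_le _).trans_lt h.start_lt
  refine ⟨h.start_lt, by rw [hlen]; simp [sys], ?_⟩
  intro B hB
  simp only [sys, List.mem_append, List.mem_map, List.mem_range, List.mem_singleton] at hB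
  rcases hB with ⟨γ, hγ, rfl⟩ | rfl
  · refine ⟨by simp [symBlock], by simp only [symBlock]; omega, by simp [symBlock], ?_⟩
    intro t ht
    rcases mem_symBlock_trans.1 ht with ⟨q, hq, hq', rfl | rfl⟩ | ⟨γ', hγ', rfl⟩
    · simp only [symBlock, Action.Valid, List.mem_singleton, forall_eq, Atom.Valid, sys]
      omega
    · have := h.nxt_lt q hq γ hγ
      have := h.act_ok q hq γ hγ hq'.2
      simp only [symBlock, Action.Valid, sys]
      refine ⟨by omega, ⟨by omega, by omega⟩, ?_⟩
      rcases this with e | ⟨e, -⟩ | ⟨γ', hγ', e, -⟩ <;> omega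
    · have := Nat.mod_lt γ h.numStk_pos
      simp only [symBlock, Action.Valid, hlen]
      simp only [sys]
      omega
  · refine ⟨by simp [mainBlock], by simp [mainBlock], by simp [mainBlock], ?_⟩
    intro t ht
    rcases mem_mainBlock_trans.1 ht with ⟨i, hi, rfl⟩ | rfl
    · have := h.numStk_le
      simp only [mainBlock, Action.Valid, hlen]
      simp only [sys]
      omega
    · simp only [mainBlock, Action.Valid, List.mem_singleton, forall_eq, Atom.Valid, sys]
      omega

/-! ### The invariant -/

/-- The vertices of the list are waiting tasks, and they hold the symbols of the second list. -/
def Waiting (G : Ctg) (l s : List ℕ) : Prop :=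
  List.Forall₂ (fun u γ => G.isCall u = false ∧ G.state u = (γ, 0)) l s

/-- The phases of the chain of vertices that represents the stack `k`, with the contents of the
stack and a weight that bounds the number of steps that the chain makes on its own. -/
inductive Phase (M : StackMachine) (G : Ctg) (q k : ℕ) : List ℕ → List ℕ → ℕ → Prop
  | absent : Phase M G q k [] [k] 3
  | call {v γ : ℕ} {l s : List ℕ} : G.isCall v = true → G.state v = (γ, 0) → Waiting G l s →
      Phase M G q k (v :: l) (γ :: s) 2
  | run {v γ : ℕ} {l s : List ℕ} : G.isCall v = false → G.state v = (γ, 0) → Waiting G l s →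
      Phase M G q k (v :: l) (γ :: s) 1
  | locked {v γ : ℕ} {l s : List ℕ} : G.isCall v = false →
      G.state v = (γ, q + (M.numSym + 2)) → q ≠ 0 → M.stk q = k → Waiting G l s →
      Phase M G q k (v :: l) (γ :: s) 0
  | final {v γ : ℕ} {l s : List ℕ} : G.isCall v = false → G.state v = (γ, 1) → Waiting G l s →
      Phase M G q k (v :: l) s 2
  | push {v γ γ' : ℕ} {l s : List ℕ} : G.isCall v = false → G.state v = (γ, γ' + 2) →
      γ' < M.numSym → Waiting G l s → Phase M G q k (v :: l) (γ' :: γ :: s) 3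

theorem Waiting.congr {G G' : Ctg} {l s : List ℕ} (h : Waiting G l s)
    (hG : ∀ u ∈ l, G'.isCall u = G.isCall u ∧ G'.state u = G.state u) : Waiting G' l s := by
  induction h with
  | nil => exact .nil
  | cons hu _ ih =>
    have := hG _ (List.mem_cons_self ..)
    exact .cons (by rwa [this.1, this.2]) (ih fun u hu => hG u (List.mem_cons_of_mem _ hu))

theorem Phase.congr {M : StackMachine} {G G' : Ctg} {q q' k w : ℕ} {l s : List ℕ}
    (h : Phase M G q k l s w)
    (hG : ∀ u ∈ l, G'.isCall u = G.isCall u ∧ G'.state u = G.state u)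
    (hq : q' = q ∨ M.stk q ≠ k) : Phase M G' q' k l s w := by
  cases h with
  | absent => exact .absent
  | call h1 h2 h3 =>
    obtain ⟨⟨e1, e2⟩, e⟩ := List.forall_mem_cons.1 hG
    exact .call (e1.trans h1) (e2.trans h2) (h3.congr e)
  | run h1 h2 h3 =>
    obtain ⟨⟨e1, e2⟩, e⟩ := List.forall_mem_cons.1 hG
    exact .run (e1.trans h1) (e2.trans h2) (h3.congr e)
  | locked h1 h2 h3 h4 h5 =>
    obtain ⟨⟨e1, e2⟩, e⟩ := List.forall_mem_cons.1 hG
    rcases hq with rfl | hq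
    · exact .locked (e1.trans h1) (e2.trans h2) h3 h4 (h5.congr e)
    · exact absurd h4 hq
  | final h1 h2 h3 =>
    obtain ⟨⟨e1, e2⟩, e⟩ := List.forall_mem_cons.1 hG
    exact .final (e1.trans h1) (e2.trans h2) (h3.congr e)
  | push h1 h2 h3 h4 =>
    obtain ⟨⟨e1, e2⟩, e⟩ := List.forall_mem_cons.1 hG
    exact .push (e1.trans h1) (e2.trans h2) h3 (h4.congr e)

/-- The configuration `c` represents the configuration `m` of the machine: the vertex `0` runs the
main block and is in state `i`, and the stack `k` is represented by the chain of vertices `ch k`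
(top first) with the weight `w k`. -/
structure Inv (M : StackMachine) (ch : ℕ → List ℕ) (w : ℕ → ℕ) (i : ℕ) (c : Config) (m : Cfg) :
    Prop where
  main_mem : 0 ∈ c.graph.verts
  main_task : c.graph.isCall 0 = false
  main_state : c.graph.state 0 = (M.numSym, i)
  le : i ≤ M.numStk + 1
  halted : i = M.numStk + 1 → m.1 = 0
  val : c.val 0 = m.1
  good : M.Good m
  cover : ∀ v ∈ c.graph.verts, v = 0 ∨ ∃ k < M.numStk, v ∈ ch k
  nodup : ∀ k < M.numStk, (ch k).Nodup
  mem : ∀ k < M.numStk, ∀ v ∈ ch k, v ∈ c.graph.verts ∧ c.graph.queue v = some k ∧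
    (c.graph.state v).1 < M.numSym ∧ (c.graph.state v).1 % M.numStk = k
  block_eq : ∀ v ∈ c.graph.verts, c.graph.block v = (c.graph.state v).1
  edge : ∀ u v, (u, v) ∈ c.graph.edges ↔ ∃ k < M.numStk, [v, u] <:+: ch k
  phase : ∀ k < M.numStk, Phase M c.graph m.1 k (ch k) (m.2 k) (w k)
  nil_iff : ∀ k < M.numStk, ch k = [] ↔ i ≤ k

section Inv

variable {M : StackMachine} {ch : ℕ → List ℕ} {w : ℕ → ℕ} {i : ℕ} {c : Config} {m : Cfg}

theorem Inv.ne_zero (h : M.Inv ch w i c m) {k v : ℕ} (hk : k < M.numStk) (hv : v ∈ ch k) :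
    v ≠ 0 := by
  rintro rfl
  have := (h.mem k hk 0 hv).2.2.1
  rw [h.main_state] at this
  exact this.false

theorem Inv.eq_of_mem (h : M.Inv ch w i c m) {k k' v : ℕ} (hk : k < M.numStk) (hv : v ∈ ch k)
    (hk' : k' < M.numStk) (hv' : v ∈ ch k') : k = k' :=
  (h.mem k hk v hv).2.2.2.symm.trans (h.mem k' hk' v hv').2.2.2

/-- A vertex with a neighbour above it in its chain has a wait edge to that neighbour. -/
theorem Inv.top_of_unblocked (h : M.Inv ch w i c m) {v : ℕ} (hv : v ∈ c.graph.verts)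
    (hu : c.graph.Unblocked v) (hs : (c.graph.state v).1 < M.numSym) :
    ∃ k < M.numStk, ∃ l, ch k = v :: l := by
  rcases h.cover v hv with rfl | ⟨k, hk, hvk⟩
  · rw [h.main_state] at hs
    exact absurd hs (lt_irrefl _)
  obtain ⟨a, b, hab⟩ := List.append_of_mem hvk
  rcases List.eq_nil_or_concat a with rfl | ⟨a, x, rfl⟩
  · exact ⟨k, hk, b, hab⟩
  · exact absurd ((h.edge v x).2 ⟨k, hk, a, b, by simp [hab]⟩) (hu x)

theorem Inv.eq_zero_of_state (h : M.Inv ch w i c m) {v : ℕ} (hv : v ∈ c.graph.verts)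
    (hs : (c.graph.state v).1 = M.numSym) : v = 0 := by
  rcases h.cover v hv with rfl | ⟨k, hk, hvk⟩
  · rfl
  · exact absurd hs (h.mem k hk v hvk).2.2.1.ne

/-- An outgoing edge would put the top at a second, lower position of its own chain, since distinct
chains are disjoint; this contradicts `nodup`. -/
theorem Inv.unblocked_top (h : M.Inv ch w i c m) {k v : ℕ} {l : List ℕ} (hk : k < M.numStk)
    (hv : ch k = v :: l) : c.graph.Unblocked v := by
  intro x hx
  obtain ⟨k', hk', a, b, hab⟩ := (h.edge v x).1 hx
  have hmem : v ∈ ch k' := by simp [← hab]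
  obtain rfl := h.eq_of_mem hk (by simp [hv]) hk' hmem
  have hn := h.nodup k hk
  rw [← hab] at hn
  rw [hv] at hab
  rcases a with - | ⟨y, a⟩
  · simp only [List.nil_append, List.cons_append, List.cons.injEq] at hab
    obtain ⟨rfl, -⟩ := hab
    simp at hn
  · simp only [List.cons_append, List.cons.injEq] at hab
    obtain ⟨rfl, -⟩ := hab
    simp at hn

theorem Inv.unblocked_main (h : M.Inv ch w i c m) : c.graph.Unblocked 0 := by
  intro x hx
  obtain ⟨k, hk, a, b, hab⟩ := (h.edge 0 x).1 hx
  exact h.ne_zero (v := 0) hk (by simp [← hab]) rfl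

/-- A step that changes only the chain of the stack `k`, the main task and the control state. -/
theorem Inv.update (h : M.Inv ch w i c m) {k : ℕ} (hk : k < M.numStk) {l' s' : List ℕ}
    {x i' q' : ℕ} {c' : Config}
    (hframe : ∀ u ∈ c.graph.verts, u ≠ 0 → u ∉ ch k → u ∈ c'.graph.verts ∧
      c'.graph.isCall u = c.graph.isCall u ∧ c'.graph.queue u = c.graph.queue u ∧
      c'.graph.state u = c.graph.state u)
    (hverts : ∀ u ∈ c'.graph.verts, u ∈ l' ∨ (u ∈ c.graph.verts ∧ u ∉ ch k))
    (hmain : 0 ∈ c'.graph.verts ∧ c'.graph.isCall 0 = false ∧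
      c'.graph.state 0 = (M.numSym, i'))
    (hle : i' ≤ M.numStk + 1) (hhalted : i' = M.numStk + 1 → q' = 0)
    (hi : ∀ j < M.numStk, j ≠ k → (i ≤ j ↔ i' ≤ j)) (hi' : k < i') (hl' : l' ≠ [])
    (hval : c'.val 0 = q') (hq : q' = m.1 ∨ M.stk m.1 = k)
    (hnodup : l'.Nodup)
    (hmem : ∀ v ∈ l', v ∈ c'.graph.verts ∧ c'.graph.queue v = some k ∧
      (c'.graph.state v).1 < M.numSym ∧ (c'.graph.state v).1 % M.numStk = k)
    (hblock : ∀ v ∈ c'.graph.verts, c'.graph.block v = (c'.graph.state v).1)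
    (hedge : ∀ u v, (u, v) ∈ c'.graph.edges ↔
      [v, u] <:+: l' ∨ ((u, v) ∈ c.graph.edges ∧ ¬ [v, u] <:+: ch k))
    (hphase : Phase M c'.graph q' k l' s' x) (hgood : M.Good (q', Function.update m.2 k s')) :
    M.Inv (Function.update ch k l') (Function.update w k x) i' c'
      (q', Function.update m.2 k s') := by
  have hne : ∀ j < M.numStk, j ≠ k → ∀ u ∈ ch j, u ∉ ch k := fun j hj hjk u hu hu' =>
    hjk (h.eq_of_mem hj hu hk hu')
  have hfr : ∀ j < M.numStk, j ≠ k → ∀ u ∈ ch j, u ∈ c'.graph.verts ∧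
      c'.graph.isCall u = c.graph.isCall u ∧ c'.graph.queue u = c.graph.queue u ∧
      c'.graph.state u = c.graph.state u := fun j hj hjk u hu =>
    hframe u (h.mem j hj u hu).1 (h.ne_zero hj hu) (hne j hj hjk u hu)
  refine ⟨hmain.1, hmain.2.1, hmain.2.2, hle, hhalted, hval, hgood, ?_, ?_, ?_, hblock, ?_, ?_, ?_⟩
  · intro v hv
    rcases hverts v hv with hv | ⟨hv, hvk⟩
    · exact .inr ⟨k, hk, by simpa using hv⟩
    · rcases h.cover v hv with rfl | ⟨j, hj, hvj⟩
      · exact .inl rfl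
      · have hjk : j ≠ k := by rintro rfl; exact hvk hvj
        exact .inr ⟨j, hj, by simpa [hjk] using hvj⟩
  · intro j hj
    by_cases hjk : j = k
    · subst hjk; simpa using hnodup
    · simpa [hjk] using h.nodup j hj
  · intro j hj v hv
    by_cases hjk : j = k
    · subst hjk; exact hmem v (by simpa using hv)
    · rw [Function.update_of_ne hjk] at hv
      obtain ⟨h1, -, h3, h4⟩ := hfr j hj hjk v hv
      rw [h3, h4]
      exact ⟨h1, (h.mem j hj v hv).2⟩
  · intro u v
    rw [hedge, h.edge]
    constructor
    · rintro (hl | ⟨⟨j, hj, hji⟩, hn⟩)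
      · exact ⟨k, hk, by simpa using hl⟩
      · have hjk : j ≠ k := by rintro rfl; exact hn hji
        exact ⟨j, hj, by simpa [hjk] using hji⟩
    · rintro ⟨j, hj, hji⟩
      by_cases hjk : j = k
      · subst hjk; exact .inl (by simpa using hji)
      · rw [Function.update_of_ne hjk] at hji
        -- Neighbours in another chain cannot also be neighbours in the old chain `ch k`, by
        -- disjointness.
        refine .inr ⟨⟨j, hj, hji⟩, fun hk' => hne j hj hjk u ?_ ?_⟩
        · exact hji.subset (by simp)
        · exact hk'.subset (by simp)
  · intro j hj
    by_cases hjk : j = k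
    · subst hjk; simpa using hphase
    · simp only [Function.update_of_ne hjk]
      -- If the control state changes, the stack it inspected is `k`, so no other chain is in the
      -- phase `locked`, the only one that mentions the control state.
      refine (h.phase j hj).congr (fun u hu => ?_) (hq.imp id fun e => by rw [e]; exact Ne.symm hjk)
      obtain ⟨-, h2, -, h4⟩ := hfr j hj hjk u hu
      exact ⟨h2, h4⟩
  · intro j hj
    by_cases hjk : j = k
    · subst hjk; simp [hl', hi']
    · simpa [hjk, ← hi j hj hjk] using h.nil_iff j hj

end Inv

/-! ### Every step of the system is a step of the machine or decreases the rank -/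

section Inversion

variable {M : StackMachine} {G : Ctg} {q k v γ x : ℕ} {l s : List ℕ}

theorem Waiting.isCall (h : Waiting G l s) {u : ℕ} (hu : u ∈ l) : G.isCall u = false := by
  induction h with
  | nil => simp at hu
  | cons h1 _ ih => rcases List.mem_cons.1 hu with rfl | hu; exacts [h1.1, ih hu]

theorem Phase.exists_waiting (h : Phase M G q k (v :: l) s x) : ∃ s', Waiting G l s' := by
  cases h <;> exact ⟨_, ‹_›⟩

/-- This and the next lemmas recover the phase from the top vertex: the states `0`, `1`, those from
`2` to `numSym + 1`, and those from `numSym + 2` on are used by different phases, and in state `0`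
the call flag decides. -/
theorem Phase.of_run (h : Phase M G q k (v :: l) s x) (hc : G.isCall v = false)
    (hs : G.state v = (γ, 0)) : ∃ s', s = γ :: s' ∧ Waiting G l s' ∧ x = 1 := by
  cases h <;> simp_all

theorem Phase.of_final (h : Phase M G q k (v :: l) s x) (hs : G.state v = (γ, 1)) :
    Waiting G l s ∧ x = 2 := by
  cases h <;> simp_all
  omega

theorem Phase.of_push {γ' : ℕ} (h : Phase M G q k (v :: l) s x)
    (hs : G.state v = (γ, γ' + 2)) (hγ' : γ' < M.numSym) :
    ∃ s', s = γ' :: γ :: s' ∧ Waiting G l s' ∧ x = 3 := by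
  cases h <;> simp_all
  omega

/-- The control state that the task saw when it passed its guard is still current, so its assignment
performs the right machine step. -/
theorem Phase.of_locked {p : ℕ} (h : Phase M G q k (v :: l) s x)
    (hs : G.state v = (γ, p + (M.numSym + 2))) :
    ∃ s', s = γ :: s' ∧ Waiting G l s' ∧ p = q ∧ q ≠ 0 ∧ M.stk q = k ∧ x = 0 := by
  cases h <;> simp_all <;> omega

theorem Phase.of_call (h : Phase M G q k (v :: l) s x) (hc : G.isCall v = true) :
    ∃ γ s', G.state v = (γ, 0) ∧ s = γ :: s' ∧ Waiting G l s' ∧ x = 2 := by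
  cases h <;> simp_all

theorem Phase.eq_cons_of_call {l : List ℕ} (h : Phase M G q k l s x) (hv : v ∈ l)
    (hc : G.isCall v = true) : ∃ r, l = v :: r := by
  rcases l with - | ⟨u, r⟩
  · simp at hv
  rcases List.mem_cons.1 hv with rfl | hv
  · exact ⟨r, rfl⟩
  · obtain ⟨s', hs'⟩ := h.exists_waiting
    rw [hs'.isCall hv] at hc
    simp at hc

end Inversion

theorem pair_infix_cons {a b x y : ℕ} {l : List ℕ} :
    [b, a] <:+: x :: y :: l ↔ (a = y ∧ b = x) ∨ [b, a] <:+: y :: l := by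
  rw [List.infix_cons_iff, List.cons_prefix_cons, List.cons_prefix_cons]
  simp [and_comm]

/-- A bound on the number of steps that the system makes before the next machine step. -/
def rank (M : StackMachine) (w : ℕ → ℕ) (i : ℕ) : ℕ :=
  ∑ k ∈ Finset.range M.numStk, w k + (M.numStk + 2 - i)

theorem rank_update_lt {M : StackMachine} {w : ℕ → ℕ} {i i' k x : ℕ} (hk : k < M.numStk)
    (hx : x < w k) (hi : i ≤ i') : M.rank (Function.update w k x) i' < M.rank w i := by
  have : ∑ j ∈ Finset.range M.numStk, Function.update w k x j <
      ∑ j ∈ Finset.range M.numStk, w j := by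
    refine Finset.sum_lt_sum (fun j _ => ?_) ⟨k, Finset.mem_range.2 hk, by simpa⟩
    by_cases hj : j = k
    · subst hj; simpa using hx.le
    · simp [hj]
  unfold rank
  omega

/-- The configuration `c` represents a machine configuration, which is `m` or its successor, and
in the first case the rank is less than `r`. -/
def Advances (M : StackMachine) (c : Config) (m : Cfg) (r : ℕ) : Prop :=
  ∃ ch w i, (∃ m', M.step m = some m' ∧ M.Inv ch w i c m') ∨ (M.Inv ch w i c m ∧ M.rank w i < r)

/-! ### The effect of each kind of system step -/

section Steps

variable {M : StackMachine} {ch : ℕ → List ℕ} {w : ℕ → ℕ} {i : ℕ} {G : Ctg} {d : ℕ → ℕ} {m : Cfg}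

theorem Inv.edge_iff (h : M.Inv ch w i ⟨G, d⟩ m) {k : ℕ} (hk : k < M.numStk) (a b : ℕ) :
    (a, b) ∈ G.edges ↔ [b, a] <:+: ch k ∨ ((a, b) ∈ G.edges ∧ ¬ [b, a] <:+: ch k) := by
  by_cases hi : [b, a] <:+: ch k
  · simpa [hi] using (h.edge a b).2 ⟨k, hk, hi⟩
  · simp [hi]

/-- A task moves to another state of its block. -/
theorem Inv.setState (h : M.Inv ch w i ⟨G, d⟩ m) {k v γ t t' q' x : ℕ} {l s' : List ℕ}
    {d' : ℕ → ℕ} (hk : k < M.numStk) (hl : ch k = v :: l) (hs : G.state v = (γ, t))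
    (hval : d' 0 = q') (hq : q' = m.1 ∨ M.stk m.1 = k) (hhalted : i = M.numStk + 1 → q' = 0)
    (hphase : Phase M (G.setState v (γ, t')) q' k (ch k) s' x)
    (hgood : M.Good (q', Function.update m.2 k s')) :
    M.Inv (Function.update ch k (ch k)) (Function.update w k x) i ⟨G.setState v (γ, t'), d'⟩
      (q', Function.update m.2 k s') := by
  have hv : v ∈ ch k := by simp [hl]
  have hv0 := h.ne_zero hk hv
  have hfst : ∀ u, ((G.setState v (γ, t')).state u).1 = (G.state u).1 := by
    intro u
    by_cases hu : u = v
    · subst hu; simp [Ctg.setState, hs]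
    · simp [Ctg.setState, hu]
  refine h.update hk ?_ ?_ ⟨h.main_mem, h.main_task, ?_⟩ h.le hhalted (fun _ _ _ => Iff.rfl) ?_
    (by simp [hl]) hval hq (h.nodup k hk) ?_
    (fun u hu => (h.block_eq u hu).trans (hfst u).symm) (h.edge_iff hk) hphase hgood
  · intro u hu _ huk
    have : u ≠ v := by rintro rfl; exact huk hv
    exact ⟨hu, rfl, rfl, by simp [Ctg.setState, this]⟩
  · intro u hu
    by_cases huk : u ∈ ch k
    · exact .inl huk
    · exact .inr ⟨hu, huk⟩
  · simpa [Ctg.setState, Ne.symm hv0] using h.main_state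
  · by_contra hc
    have := (h.nil_iff k hk).2 (by omega)
    simp [hl] at this
  · intro u hu
    rw [hfst u]
    exact h.mem k hk u hu

theorem Inv.waiting_setState (h : M.Inv ch w i ⟨G, d⟩ m) {k v : ℕ} {l s : List ℕ}
    (hk : k < M.numStk) (hl : ch k = v :: l) (hw : Waiting G l s) (t : Loc) :
    Waiting (G.setState v t) l s := by
  have hn := h.nodup k hk
  rw [hl, List.nodup_cons] at hn
  refine hw.congr fun u hu => ⟨rfl, ?_⟩
  have : u ≠ v := by rintro rfl; exact hn.1 hu
  simp [Ctg.setState, this]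

theorem Inv.advances_guard (h : M.Inv ch w i ⟨G, d⟩ m) {v γ q : ℕ} (hγ : γ < M.numSym)
    (hq0 : q ≠ 0) (hstk : γ % M.numStk = M.stk q) (hd : d 0 = q) (hv : G.IsTask v)
    (hu : G.Unblocked v) (hs : G.state v = (γ, 0)) :
    M.Advances ⟨G.setState v (γ, q + (M.numSym + 2)), d⟩ m (M.rank w i) := by
  obtain ⟨k, hk, l, hl⟩ := h.top_of_unblocked hv.1 hu (by simpa [hs] using hγ)
  have hp := h.phase k hk
  rw [hl] at hp
  obtain ⟨s', hs', hw, hx⟩ := hp.of_run hv.2 hs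
  have hmk := (h.mem k hk v (by simp [hl])).2.2.2
  simp only [hs] at hmk
  obtain rfl : q = m.1 := hd.symm.trans h.val
  have hgood : M.Good (m.1, Function.update m.2 k (m.2 k)) := by simpa using h.good
  have key := h.setState (t' := m.1 + (M.numSym + 2)) (x := 0) (s' := m.2 k) hk hl hs h.val
    (.inl rfl) h.halted ?_ hgood
  · refine ⟨_, _, _, .inr ⟨by simpa using key, rank_update_lt hk (by omega) le_rfl⟩⟩
  · rw [hl, hs']
    exact .locked hv.2 (by simp [Ctg.setState]) hq0 (by omega) (h.waiting_setState hk hl hw _)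

/-- The machine step is accounted for here: the phases `final` and `push` already show the new stack
contents, and the chain catches up afterwards. Since the machine configuration advances, the bound
`r` may be arbitrary. -/
theorem Inv.advances_assign (hM : M.WF) (h : M.Inv ch w i ⟨G, d⟩ m) {v γ q : ℕ}
    (hγ : γ < M.numSym) (hv : G.IsTask v)
    (hu : G.Unblocked v) (hs : G.state v = (γ, q + (M.numSym + 2))) (r : ℕ) :
    M.Advances ⟨G.setState v (γ, M.act q γ), Function.update d 0 (M.nxt q γ)⟩ m r := by
  obtain ⟨k, hk, l, hl⟩ := h.top_of_unblocked hv.1 hu (by simpa [hs] using hγ)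
  have hp := h.phase k hk
  rw [hl] at hp
  obtain ⟨s', hs', hw, rfl, hq0, rfl, hx⟩ := hp.of_locked hs
  have hmk := (h.mem _ hk v (by simp [hl])).2.2.2
  simp only [hs] at hmk
  have hstep := step_eq_some hq0 hs'
  have hgood := hM.good_step h.good hstep
  have hh : i = M.numStk + 1 → M.nxt m.1 γ = 0 := fun e => absurd (h.halted e) hq0
  have hw' := h.waiting_setState hk hl hw (γ, M.act m.1 γ)
  have hself : (G.setState v (γ, M.act m.1 γ)).state v = (γ, M.act m.1 γ) := by
    simp [Ctg.setState]
  have : ∃ x, Phase M (G.setState v (γ, M.act m.1 γ)) (M.nxt m.1 γ) (M.stk m.1)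
      (ch (M.stk m.1)) (applyAct (M.act m.1 γ) γ s') x := by
    rw [hl]
    rcases hM.act_ok _ h.good.ctl γ hγ hmk with e | ⟨e, -⟩ | ⟨γ', hγ', e, -⟩
    · rw [e] at hself hw' ⊢
      exact ⟨1, .run hv.2 hself hw'⟩
    · rw [e] at hself hw' ⊢
      exact ⟨2, .final hv.2 hself hw'⟩
    · rw [e] at hself hw' ⊢
      exact ⟨3, .push hv.2 hself hγ' hw'⟩
  obtain ⟨x, hphase⟩ := this
  exact ⟨_, _, _, .inl ⟨_, hstep, h.setState hk hl hs (by simp) (.inr rfl) hh hphase hgood⟩⟩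

theorem Inv.advances_main_guard (hM : M.WF) (h : M.Inv ch w i ⟨G, d⟩ m) (hi : i = M.numStk)
    (hd : d 0 = 0) :
    M.Advances ⟨G.setState 0 (M.numSym, M.numStk + 1), d⟩ m (M.rank w i) := by
  have hk := hM.numStk_pos
  have hst : ∀ u ≠ 0, (G.setState 0 (M.numSym, M.numStk + 1)).state u = G.state u :=
    fun u hu => by simp [Ctg.setState, hu]
  -- `Inv.update` is applied to the stack `0` with unchanged chain and contents, since only the main
  -- task moves.
  have key := h.update (i' := M.numStk + 1) (s' := m.2 0) (q' := m.1) (l' := ch 0) (x := w 0)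
    (c' := ⟨G.setState 0 (M.numSym, M.numStk + 1), d⟩) hk
    (fun u hu hu0 _ => ⟨hu, rfl, rfl, hst u hu0⟩)
    (fun u hu => (em (u ∈ ch 0)).imp id fun hn => ⟨hu, hn⟩)
    ⟨h.main_mem, h.main_task, by simp [Ctg.setState]⟩ le_rfl
    (fun _ => h.val.symm.trans hd) (fun j hj _ => by omega) (by omega)
    (fun e => by have := (h.nil_iff 0 hk).1 e; omega) h.val (.inl rfl) (h.nodup 0 hk)
    (fun v hv => by
      have := h.mem 0 hk v hv
      simp only [hst v (h.ne_zero hk hv)]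
      exact this)
    (fun u hu => by
      by_cases hu0 : u = 0
      · subst hu0
        refine (h.block_eq 0 hu).trans ((congrArg Prod.fst h.main_state).trans ?_)
        simp [Ctg.setState]
      · exact (h.block_eq u hu).trans (by simp only [hst u hu0]))
    (h.edge_iff hk)
    ((h.phase 0 hk).congr (fun u hu => ⟨rfl, hst u (h.ne_zero hk hu)⟩) (.inl rfl))
    (by simpa using h.good)
  refine ⟨_, _, _, .inr ⟨by simpa using key, ?_⟩⟩
  -- The contribution of the main task drops from 2 to 1.
  simp only [rank]
  omega

/-- All vertices below the top of a chain are tasks. So each queue holds at most one call, and the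
FIFO order plays no role. -/
theorem Inv.queue_call (h : M.Inv ch w i ⟨G, d⟩ m) {k v : ℕ} (hc : G.IsCallOf k v) :
    k < M.numStk ∧ ∃ l, ch k = v :: l := by
  obtain ⟨hv, hcall, hq⟩ := hc
  rcases h.cover v hv with rfl | ⟨j, hj, hvj⟩
  · have := h.main_task
    simp_all
  · have := (h.mem j hj v hvj).2.1
    simp only [hq, Option.some_inj] at this
    subst this
    exact ⟨hj, (h.phase k hj).eq_cons_of_call hvj hcall⟩

theorem Inv.advances_fork (h : M.Inv ch w i ⟨G, d⟩ m) {v γ γ' v' : ℕ}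
    (hγ : γ < M.numSym) (hγ' : γ' < M.numSym) (hv : G.IsTask v) (hu : G.Unblocked v)
    (hs : G.state v = (γ, γ' + 2)) (hv' : v' ∉ G.verts) :
    M.Advances ⟨((G.setState v (γ, 0)).enqueue M.sys (γ % M.numStk) γ' v').letwait v v', d⟩ m
      (M.rank w i) := by
  obtain ⟨k, hk, l, hl⟩ := h.top_of_unblocked hv.1 hu (by simpa [hs] using hγ)
  have hp := h.phase k hk
  rw [hl] at hp
  obtain ⟨s', hs', hw, hx⟩ := hp.of_push hs hγ'
  have hvk : v ∈ ch k := by simp [hl]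
  have hmk := (h.mem k hk v hvk).2.2.2
  simp only [hs] at hmk
  subst hmk
  have hγk : γ' % M.numStk = γ % M.numStk :=
    (h.good.sym _ hk γ' (by simp [hs'])).2
  have hinit : M.sys.initLoc γ' = (γ', 0) := by simp [EQdas.initLoc, sys_block_sym M hγ', symBlock]
  have hvv' : v ≠ v' := by rintro rfl; exact hv' hv.1
  have hne : ∀ u ∈ G.verts, u ≠ v' := by rintro u hu rfl; exact hv' hu
  set G' := ((G.setState v (γ, 0)).enqueue M.sys (γ % M.numStk) γ' v').letwait v v' with hG'
  -- A call in this queue would be the top of the chain, but the top `v` is a task. The queue is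
  -- empty, and the new call gets no queue edge.
  have htail : ∀ u, ¬ (G.setState v (γ, 0)).IsTail (γ % M.numStk) u := by
    rintro u ⟨hu', -⟩
    obtain ⟨-, l', hl'⟩ := h.queue_call (v := u) hu'
    rw [hl] at hl'
    obtain ⟨rfl, -⟩ := List.cons.inj hl'
    have := hu'.2.1
    simp only [Ctg.setState, hv.2] at this
    exact Bool.false_ne_true this
  have hedges : ∀ a b, (a, b) ∈ G'.edges ↔ (a = v ∧ b = v') ∨ (a, b) ∈ G.edges := by
    intro a b
    simp only [hG', Ctg.letwait, Ctg.enqueue, Set.mem_union, Set.mem_ofPred_eq,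
      Set.mem_singleton_iff, Prod.mk.injEq, htail, and_false, or_false]
    exact or_comm
  have hst : ∀ u, u ≠ v → u ≠ v' → G'.state u = G.state u := fun u h1 h2 => by
    simp [hG', Ctg.letwait, Ctg.enqueue, Ctg.setState, h1, h2]
  have hcl : ∀ u, u ≠ v' → G'.isCall u = G.isCall u := fun u h2 => by
    simp [hG', Ctg.letwait, Ctg.enqueue, Ctg.setState, h2]
  have hqu : ∀ u, u ≠ v' → G'.queue u = G.queue u := fun u h2 => by
    simp [hG', Ctg.letwait, Ctg.enqueue, Ctg.setState, h2]
  have hstv : G'.state v = (γ, 0) := by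
    simp [hG', Ctg.letwait, Ctg.enqueue, Ctg.setState, hvv']
  have hstv' : G'.state v' = (γ', 0) := by
    simp [hG', Ctg.letwait, Ctg.enqueue, hinit]
  have hverts : ∀ u, u ∈ G'.verts ↔ u = v' ∨ u ∈ G.verts := fun u => by
    simp [hG', Ctg.letwait, Ctg.enqueue, Ctg.setState]
  have hn := h.nodup _ hk
  have hv0 := h.ne_zero hk hvk
  have hwait : Waiting G' l s' := by
    rw [hl, List.nodup_cons] at hn
    refine hw.congr fun u hul => ?_
    have h1 : u ≠ v := by rintro rfl; exact hn.1 hul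
    have h2 := hne u (h.mem _ hk u (by simp [hl, hul])).1
    exact ⟨hcl u h2, hst u h1 h2⟩
  have key := h.update (i' := i) (s' := m.2 (γ % M.numStk)) (q' := m.1)
    (l' := v' :: ch (γ % M.numStk)) (x := 2) (c' := ⟨G', d⟩) hk
    (fun u hu _ huk => by
      have h1 : u ≠ v := by rintro rfl; exact huk hvk
      have h2 := hne u hu
      exact ⟨(hverts u).2 (.inr hu), hcl u h2, hqu u h2, hst u h1 h2⟩)
    (fun u hu => by
      rcases (hverts u).1 hu with rfl | hu
      · exact .inl (by simp)
      · exact (em (u ∈ ch (γ % M.numStk))).imp (fun e => by simp [e]) fun hn => ⟨hu, hn⟩)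
    ⟨(hverts 0).2 (.inr h.main_mem), (hcl 0 (hne 0 h.main_mem)).trans h.main_task,
      (hst 0 (Ne.symm hv0) (hne 0 h.main_mem)).trans h.main_state⟩ h.le h.halted
    (fun _ _ _ => Iff.rfl)
    (by
      by_contra hc
      have := (h.nil_iff _ hk).2 (by omega)
      simp [hl] at this)
    (by simp) h.val (.inl rfl)
    (List.nodup_cons.2 ⟨fun hm => hv' (h.mem _ hk v' hm).1, hn⟩)
    (fun u hu => by
      rcases List.mem_cons.1 hu with rfl | hu
      · refine ⟨(hverts u).2 (.inl rfl), by simp [hG', Ctg.letwait, Ctg.enqueue], ?_⟩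
        simp only [hstv']
        exact ⟨hγ', hγk⟩
      · obtain ⟨h1, h2, h3⟩ := h.mem _ hk u hu
        have h4 := hne u h1
        refine ⟨(hverts u).2 (.inr h1), (hqu u h4).trans h2, ?_⟩
        by_cases huv : u = v
        · subst huv
          simp only [hstv]
          exact ⟨hγ, trivial⟩
        · simp only [hst u huv h4]
          exact h3)
    (fun u hu => by
      by_cases huv : u = v'
      · subst huv
        simp only [hstv']
        simp [hG', Ctg.letwait, Ctg.enqueue]
      · refine (?_ : G'.block u = G.block u).trans
          ((h.block_eq u (((hverts u).1 hu).resolve_left huv)).trans ?_)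
        · simp [hG', Ctg.letwait, Ctg.enqueue, Ctg.setState, huv]
        · by_cases huv' : u = v
          · subst huv'
            simp only [hstv, hs]
          · simp only [hst u huv' huv])
    (fun a b => by
      have e := h.edge_iff hk a b
      rw [hl] at e ⊢
      rw [hedges, pair_infix_cons, or_assoc]
      exact or_congr_right e)
    (by
      rw [hl, hs']
      refine .call (by simp [hG', Ctg.letwait, Ctg.enqueue]) hstv' (.cons ⟨?_, hstv⟩ hwait)
      exact (hcl v hvv').trans hv.2)
    (by simpa using h.good)
  exact ⟨_, _, _, .inr ⟨by simpa using key, rank_update_lt hk (by omega) le_rfl⟩⟩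

/-- The stack `i` was already credited with its bottom marker in the phase `absent`, so the machine
configuration does not change. The machine may even run before all bottoms are dispatched. -/
theorem Inv.advances_dispatch (hM : M.WF) (h : M.Inv ch w i ⟨G, d⟩ m) (hi : i < M.numStk)
    {v' : ℕ} (hv' : v' ∉ G.verts) :
    M.Advances ⟨(G.setState 0 (M.numSym, i + 1)).enqueue M.sys i i v', d⟩ m (M.rank w i) := by
  have hi' : i < M.numSym := hi.trans_le hM.numStk_le
  have hnil := (h.nil_iff i hi).2 le_rfl
  have hp := h.phase i hi
  rw [hnil] at hp
  have hsw : m.2 i = [i] ∧ w i = 3 := by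
    generalize m.2 i = s, w i = x at hp
    cases hp
    exact ⟨rfl, rfl⟩
  have hinit : M.sys.initLoc i = (i, 0) := by simp [EQdas.initLoc, sys_block_sym M hi', symBlock]
  have hne : ∀ u ∈ G.verts, u ≠ v' := by rintro u hu rfl; exact hv' hu
  set G' := (G.setState 0 (M.numSym, i + 1)).enqueue M.sys i i v' with hG'
  have htail : ∀ u, ¬ (G.setState 0 (M.numSym, i + 1)).IsTail i u := by
    rintro u ⟨hu', -⟩
    obtain ⟨-, l', hl'⟩ := h.queue_call (v := u) hu'
    simp [hnil] at hl'
  have hedges : ∀ a b, (a, b) ∈ G'.edges ↔ (a, b) ∈ G.edges := by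
    intro a b
    simp only [hG', Ctg.enqueue, Set.mem_union, Set.mem_ofPred_eq, htail, and_false, or_false]
    exact Iff.rfl
  have hst : ∀ u, u ≠ 0 → u ≠ v' → G'.state u = G.state u := fun u h1 h2 => by
    simp [hG', Ctg.enqueue, Ctg.setState, h1, h2]
  have hcl : ∀ u, u ≠ v' → G'.isCall u = G.isCall u := fun u h2 => by
    simp [hG', Ctg.enqueue, Ctg.setState, h2]
  have hqu : ∀ u, u ≠ v' → G'.queue u = G.queue u := fun u h2 => by
    simp [hG', Ctg.enqueue, Ctg.setState, h2]
  have hstv' : G'.state v' = (i, 0) := by simp [hG', Ctg.enqueue, hinit]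
  have h0 : 0 ≠ v' := hne 0 h.main_mem
  have hverts : ∀ u, u ∈ G'.verts ↔ u = v' ∨ u ∈ G.verts := fun u => by
    simp [hG', Ctg.enqueue, Ctg.setState]
  have key := h.update (i' := i + 1) (s' := m.2 i) (q' := m.1) (l' := [v']) (x := 2)
    (c' := ⟨G', d⟩) hi
    (fun u hu hu0 _ => by
      have h2 := hne u hu
      exact ⟨(hverts u).2 (.inr hu), hcl u h2, hqu u h2, hst u hu0 h2⟩)
    (fun u hu => ((hverts u).1 hu).imp (fun e => by simp [e]) fun e => ⟨e, by simp [hnil]⟩)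
    ⟨(hverts 0).2 (.inr h.main_mem), (hcl 0 h0).trans h.main_task,
      by simp [hG', Ctg.enqueue, Ctg.setState, h0]⟩ (by omega) (by omega)
    (fun j _ hj => by omega) (by omega) (by simp) h.val (.inl rfl) (by simp)
    (fun u hu => by
      obtain rfl : u = v' := by simpa using hu
      refine ⟨(hverts u).2 (.inl rfl), by simp [hG', Ctg.enqueue], ?_⟩
      simp only [hstv']
      exact ⟨hi', Nat.mod_eq_of_lt hi⟩)
    (fun u hu => by
      by_cases huv : u = v'
      · subst huv
        simp only [hstv']
        simp [hG', Ctg.enqueue]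
      · refine (?_ : G'.block u = G.block u).trans
          ((h.block_eq u (((hverts u).1 hu).resolve_left huv)).trans ?_)
        · simp [hG', Ctg.enqueue, Ctg.setState, huv]
        · by_cases hu0 : u = 0
          · subst hu0
            refine (congrArg Prod.fst h.main_state).trans ?_
            simp [hG', Ctg.enqueue, Ctg.setState, huv]
          · simp only [hst u hu0 huv])
    (fun a b => by
      rw [hedges, hnil]
      have h1 : ¬ [b, a] <:+: [v'] := fun e => by simpa using e.length_le
      have h2 : ¬ [b, a] <:+: ([] : List ℕ) := fun e => by simpa using e.length_le
      simp only [h1, h2, false_or, not_false_iff, and_true])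
    (by
      rw [hsw.1]
      exact .call (by simp [hG', Ctg.enqueue]) hstv' .nil)
    (by simpa using h.good)
  exact ⟨_, _, _, .inr ⟨by simpa using key, rank_update_lt hi (by omega) (by omega)⟩⟩

theorem Inv.advances_terminate (h : M.Inv ch w i ⟨G, d⟩ m) {v : ℕ} (hv : G.IsFinal M.sys v) :
    M.Advances ⟨G.remove v, d⟩ m (M.rank w i) := by
  obtain ⟨ht, hu, hs⟩ := hv
  -- The main task is never final: its state is at most `numStk + 1`, its final state is `numStk +
  -- 2`. The flag it raises therefore stays.
  have hlt : (G.state v).1 < M.numSym := by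
    rcases h.cover v ht.1 with rfl | ⟨k, hk, hvk⟩
    · have h1 := h.main_state
      have h2 := h.le
      simp only [hs, EQdas.finalLoc, Prod.mk.injEq] at h1
      rw [h1.1, sys_block_main] at h1
      simp only [mainBlock] at h1
      omega
    · exact (h.mem k hk v hvk).2.2.1
  obtain ⟨k, hk, l, hl⟩ := h.top_of_unblocked ht.1 hu hlt
  have hs1 : G.state v = (G.block v, 1) := by
    simp only [hs, EQdas.finalLoc] at hlt ⊢
    simp [sys_block_sym M hlt, symBlock]
  have hp := h.phase k hk
  rw [hl] at hp
  obtain ⟨hw, hx⟩ := hp.of_final hs1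
  have hvk : v ∈ ch k := by simp [hl]
  have hv0 := h.ne_zero hk hvk
  have hn := h.nodup k hk
  rw [hl, List.nodup_cons] at hn
  obtain ⟨r, hr⟩ := h.good.bot k hk
  have hverts : ∀ u, u ∈ (G.remove v).verts ↔ u ≠ v ∧ u ∈ G.verts := fun u => by
    simp [Ctg.remove]
  -- A task must remain below the terminating one, because the contents that are left still include
  -- the bottom marker.
  rcases l with - | ⟨u₀, l⟩
  · rw [hr] at hw
    cases r <;> simp [Waiting] at hw
  have key := h.update (i' := i) (s' := m.2 k) (q' := m.1) (l' := u₀ :: l) (x := 1)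
    (c' := ⟨G.remove v, d⟩) hk
    (fun u hu _ huk => by
      have h1 : u ≠ v := by rintro rfl; exact huk hvk
      exact ⟨(hverts u).2 ⟨h1, hu⟩, rfl, rfl, rfl⟩)
    (fun u hu => by
      obtain ⟨h1, h2⟩ := (hverts u).1 hu
      rw [hl]
      by_cases hul : u ∈ u₀ :: l
      · exact .inl hul
      · exact .inr ⟨h2, by simp only [List.mem_cons, not_or] at hul ⊢; exact ⟨h1, hul⟩⟩)
    ⟨(hverts 0).2 ⟨Ne.symm hv0, h.main_mem⟩, h.main_task, h.main_state⟩ h.le h.halted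
    (fun _ _ _ => Iff.rfl)
    (by
      by_contra hc
      have := (h.nil_iff _ hk).2 (by omega)
      simp [hl] at this)
    (by simp) h.val (.inl rfl) hn.2
    (fun u hul => by
      obtain ⟨h1, h2⟩ := h.mem k hk u (by rw [hl]; exact List.mem_cons_of_mem _ hul)
      exact ⟨(hverts u).2 ⟨by rintro rfl; exact hn.1 hul, h1⟩, h2⟩)
    (fun u hu => h.block_eq u ((hverts u).1 hu).2)
    (fun a b => by
      have he : (a, b) ∈ (G.remove v).edges ↔ (a, b) ∈ G.edges ∧ a ≠ v ∧ b ≠ v := Iff.rfl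
      simp only [he]
      constructor
      · rintro ⟨h1, h2, h3⟩
        rcases (h.edge_iff hk a b).1 h1 with h4 | h4
        · rw [hl, pair_infix_cons] at h4
          exact .inl (h4.resolve_left fun e => h3 e.2)
        · exact .inr h4
      · rintro (h1 | ⟨h1, h2⟩)
        · refine ⟨(h.edge a b).2 ⟨k, hk, ?_⟩, ?_, ?_⟩
          · rw [hl, pair_infix_cons]
            exact .inr h1
          · rintro rfl
            exact hn.1 (h1.subset (by simp))
          · rintro rfl
            exact hn.1 (h1.subset (by simp))
        · obtain ⟨j, hj, hji⟩ := (h.edge a b).1 h1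
          refine ⟨h1, ?_, ?_⟩
          · rintro rfl
            obtain rfl := h.eq_of_mem hk hvk hj (hji.subset (by simp))
            exact h2 hji
          · rintro rfl
            obtain rfl := h.eq_of_mem hk hvk hj (hji.subset (by simp))
            exact h2 hji)
    (by
      generalize m.2 k = s at hw
      cases hw with
      | cons h1 h2 => exact .run h1.1 h1.2 h2)
    (by simpa using h.good)
  exact ⟨_, _, _, .inr ⟨by simpa using key, rank_update_lt hk (by omega) le_rfl⟩⟩

theorem Inv.advances_schedule (h : M.Inv ch w i ⟨G, d⟩ m) {k v : ℕ} (hv : G.IsHead k v) :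
    M.Advances ⟨G.dequeue k v, d⟩ m (M.rank w i) := by
  obtain ⟨hk, l, hl⟩ := h.queue_call hv.1
  have hp := h.phase k hk
  rw [hl] at hp
  obtain ⟨γ, s', hs, hs', hw, hx⟩ := hp.of_call hv.1.2.1
  have hvk : v ∈ ch k := by simp [hl]
  have hv0 := h.ne_zero hk hvk
  have hn := h.nodup k hk
  -- Scheduling removes no edge: the source of a queue edge into `v` would be a call of the same
  -- queue, hence `v` itself, which as a head has no outgoing queue edge.
  have hedges : ∀ a b, (a, b) ∈ (G.dequeue k v).edges ↔ (a, b) ∈ G.edges := by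
    intro a b
    simp only [Ctg.dequeue, Set.mem_ofPred_eq, and_iff_left_iff_imp]
    rintro - ⟨rfl, hqe⟩
    obtain ⟨-, l', hl'⟩ := h.queue_call hqe.2.1
    rw [hl] at hl'
    obtain ⟨rfl, -⟩ := List.cons.inj hl'
    exact hv.2 _ hqe
  have hcl : ∀ u, u ≠ v → (G.dequeue k v).isCall u = G.isCall u := fun u h1 => by
    simp [Ctg.dequeue, h1]
  have key := h.update (i' := i) (s' := m.2 k) (q' := m.1) (l' := ch k) (x := 1)
    (c' := ⟨G.dequeue k v, d⟩) hk
    (fun u hu _ huk => by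
      have h1 : u ≠ v := by rintro rfl; exact huk hvk
      exact ⟨hu, hcl u h1, rfl, rfl⟩)
    (fun u hu => (em (u ∈ ch k)).imp id fun hn => ⟨hu, hn⟩)
    ⟨h.main_mem, (hcl 0 (Ne.symm hv0)).trans h.main_task, h.main_state⟩ h.le h.halted
    (fun _ _ _ => Iff.rfl)
    (by
      by_contra hc
      have := (h.nil_iff _ hk).2 (by omega)
      simp [hl] at this)
    (by simp [hl]) h.val (.inl rfl) hn (fun u hu => h.mem k hk u hu) h.block_eq
    (fun a b => (hedges a b).trans (h.edge_iff hk a b))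
    (by
      rw [hl, List.nodup_cons] at hn
      rw [hl, hs']
      refine .run (by simp [Ctg.dequeue]) hs (hw.congr fun u hu => ⟨hcl u ?_, rfl⟩)
      rintro rfl
      exact hn.1 hu)
    (by simpa using h.good)
  exact ⟨_, _, _, .inr ⟨by simpa using key, rank_update_lt hk (by omega) le_rfl⟩⟩

end Steps

/-- The transition table leaves one kind of symbol-task or main transition for each action and
location; each case is one of the lemmas above. -/
theorem Inv.advances {M : StackMachine} (hM : M.WF) {ch : ℕ → List ℕ} {w : ℕ → ℕ} {i : ℕ}
    {c c' : Config} {m : Cfg} {a : Option Action} (h : M.Inv ch w i c m)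
    (ht : M.sys.Trans c a c') : M.Advances c' m (M.rank w i) := by
  cases ht with
  | dispatchAsync v' hδ hst hv' =>
    obtain ⟨ht, hu, hs, rfl⟩ := hst
    rcases mem_delta.1 hδ with (⟨j, hj, e⟩ | e) |
        ⟨γ, hγ, ⟨q', hq', hq'', e | e⟩ | ⟨γ', hγ', e⟩⟩ <;>
      simp only [Prod.mk.injEq, Action.dispatchAsync.injEq, reduceCtorEq, and_false,
        false_and] at e
    obtain ⟨rfl, ⟨rfl, rfl⟩, rfl⟩ := e
    obtain rfl := h.eq_zero_of_state ht.1 (by simp [hs])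
    have := h.main_state.symm.trans hs
    simp only [Prod.mk.injEq, true_and] at this
    subst this
    exact h.advances_dispatch hM hj hv'
  | forkjoin n hδ hst hp hf =>
    obtain ⟨ht, hu, hs, rfl⟩ := hst
    rcases mem_delta.1 hδ with (⟨j, hj, e⟩ | e) |
        ⟨γ, hγ, ⟨q', hq', hq'', e | e⟩ | ⟨γ', hγ', e⟩⟩ <;>
      simp only [Prod.mk.injEq, Action.forkjoin.injEq, reduceCtorEq, and_false,
        false_and] at e
    obtain ⟨rfl, ⟨rfl, rfl, rfl⟩, rfl⟩ := e
    obtain rfl : n = 1 := by simpa [eq_comm] using hp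
    cases hf with
    | succ v' hf hv' =>
      cases hf
      exact h.advances_fork hγ hγ' ht hu hs hv'
  | guard hδ hg hst =>
    obtain ⟨ht, hu, hs, rfl⟩ := hst
    rcases mem_delta.1 hδ with (⟨j, hj, e⟩ | e) |
        ⟨γ, hγ, ⟨q', hq', hq'', e | e⟩ | ⟨γ', hγ', e⟩⟩ <;>
      simp only [Prod.mk.injEq, Action.guard.injEq, reduceCtorEq, and_false,
        false_and] at e
    · obtain ⟨rfl, rfl, rfl⟩ := e
      obtain rfl := h.eq_zero_of_state ht.1 (by simp [hs])
      have := h.main_state.symm.trans hs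
      simp only [Prod.mk.injEq, true_and] at this
      exact h.advances_main_guard hM this (by simpa [Atom.Holds] using hg)
    · obtain ⟨rfl, rfl, rfl⟩ := e
      exact h.advances_guard hγ hq''.1 hq''.2 (by simpa [Atom.Holds] using hg) ht hu hs
  | assign hδ hst =>
    obtain ⟨ht, hu, hs, rfl⟩ := hst
    rcases mem_delta.1 hδ with (⟨j, hj, e⟩ | e) |
        ⟨γ, hγ, ⟨q', hq', hq'', e | e⟩ | ⟨γ', hγ', e⟩⟩ <;>
      simp only [Prod.mk.injEq, Action.assign.injEq, reduceCtorEq, and_false,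
        false_and] at e
    obtain ⟨rfl, ⟨rfl, rfl⟩, rfl⟩ := e
    exact h.advances_assign hM hγ ht hu hs _
  | terminate hf => exact h.advances_terminate hf
  | schedule _ hh _ => exact h.advances_schedule hh

open StateTransition

/-! ### Progress of the system -/

/-- Either the main task still has a bottom to dispatch, or it can notice that the machine has
halted, or the chain of the inspected stack is nonempty and its top can move in each of its phases.
-/
theorem Inv.enabled {M : StackMachine} (hM : M.WF) {ch : ℕ → List ℕ} {w : ℕ → ℕ} {i : ℕ}
    {c : Config} {m : Cfg} (h : M.Inv ch w i c m) (hc : m.1 ≠ 0 ∨ i ≤ M.numStk) :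
    ∃ a c', M.sys.Trans c a c' := by
  obtain ⟨G, d⟩ := c
  have hmain : G.IsTask 0 := ⟨h.main_mem, h.main_task⟩
  have hmainu : G.Unblocked 0 := h.unblocked_main
  have hmains : G.state 0 = (M.numSym, i) := h.main_state
  rcases lt_or_ge i M.numStk with hi | hi
  · obtain ⟨v', hv'⟩ := Infinite.exists_notMem_finset G.verts
    exact ⟨_, _, .dispatchAsync v' (mem_delta.2 (.inl (.inl ⟨i, hi, rfl⟩)))
      ⟨hmain, hmainu, hmains, rfl⟩ hv'⟩
  by_cases h0 : m.1 = 0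
  · obtain rfl : i = M.numStk := le_antisymm (hc.resolve_left fun e => e h0) hi
    refine ⟨_, _, .guard (mem_delta.2 (.inl (.inr rfl))) ?_ ⟨hmain, hmainu, hmains, rfl⟩⟩
    simpa [Atom.Holds] using h.val.trans h0
  have hk := hM.stk_lt _ h.good.ctl
  have hp := h.phase _ hk
  have hne : ch (M.stk m.1) ≠ [] := fun e => by
    have := (h.nil_iff _ hk).1 e
    omega
  obtain ⟨v, l, hl⟩ := List.exists_cons_of_ne_nil hne
  obtain ⟨hv, hqueue, hsym, hmod⟩ := h.mem _ hk v (by simp [hl])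
  have hu : G.Unblocked v := h.unblocked_top hk hl
  change v ∈ G.verts at hv
  change G.queue v = _ at hqueue
  change (G.state v).1 < _ at hsym
  change (G.state v).1 % _ = _ at hmod
  rw [hl] at hp
  change Phase M G _ _ _ _ _ at hp
  have hblk : G.block v = (G.state v).1 := h.block_eq v hv
  generalize m.2 (M.stk m.1) = s, w (M.stk m.1) = x at hp
  cases hp with
  | call h1 h2 h3 =>
    exact ⟨_, _, .schedule hk ⟨⟨hv, h1, hqueue⟩, fun u hu' => hu u hu'.1⟩ hu⟩
  | run h1 h2 h3 =>
    rw [h2] at hsym hmod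
    refine ⟨_, _, .guard
      (mem_delta.2 (.inr ⟨_, hsym, .inl ⟨_, h.good.ctl, ⟨h0, hmod⟩, .inl rfl⟩⟩)) ?_
      ⟨⟨hv, h1⟩, hu, h2, rfl⟩⟩
    simpa [Atom.Holds] using h.val
  | locked h1 h2 h3 h4 h5 =>
    rw [h2] at hsym hmod
    exact ⟨_, _, .assign
      (mem_delta.2 (.inr ⟨_, hsym, .inl ⟨_, h.good.ctl, ⟨h0, hmod⟩, .inr rfl⟩⟩))
      ⟨⟨hv, h1⟩, hu, h2, rfl⟩⟩
  | final h1 h2 h3 =>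
    rw [h2] at hsym hblk
    refine ⟨_, _, .terminate ⟨⟨hv, h1⟩, hu, ?_⟩⟩
    rw [h2, hblk, EQdas.finalLoc, sys_block_sym M hsym, symBlock]
  | push h1 h2 h3 h4 =>
    rw [h2] at hsym
    obtain ⟨v', hv'⟩ := Infinite.exists_notMem_finset G.verts
    exact ⟨_, _, .forkjoin 1 (mem_delta.2 (.inr ⟨_, hsym, .inr ⟨_, h3, rfl⟩⟩))
      ⟨⟨hv, h1⟩, hu, h2, rfl⟩ (.inr rfl) (.succ v' (.zero _) hv')⟩

/-! ### Halting -/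

def Halts (M : StackMachine) : Prop := ∃ m, Reaches M.step M.initCfg m ∧ m.1 = 0

theorem WF.good_of_reaches {M : StackMachine} (hM : M.WF) {m m' : Cfg} (hm : M.Good m)
    (h : Reaches M.step m m') : M.Good m' := by
  induction h with
  | refl => exact hm
  | tail _ hs ih => exact hM.good_step ih hs

/-- A machine in a good configuration gets stuck only in the control state `0`, since its stacks are
never empty. -/
theorem WF.eval_dom_iff {M : StackMachine} (hM : M.WF) :
    (eval M.step M.initCfg).Dom ↔ M.Halts := by
  rw [Part.dom_iff_mem]
  refine exists_congr fun m => ?_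
  rw [mem_eval]
  refine and_congr_right fun hr => ⟨fun hs => ?_, fun h0 => by simp [step, h0]⟩
  by_contra h0
  obtain ⟨m', hm'⟩ := (hM.good_of_reaches hM.good_init hr).step_ne_none hM h0
  simp [hs] at hm'

theorem WF.inv_init {M : StackMachine} (hM : M.WF) :
    M.Inv (fun _ => []) (fun _ => 3) 0 M.sys.initConfig M.initCfg where
  main_mem := by simp [EQdas.initConfig]
  main_task := rfl
  main_state := by
    change (M.numSym, (M.sys.block M.numSym).init) = _
    rw [sys_block_main]
    rfl
  le := Nat.zero_le _
  halted h := by omega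
  val := rfl
  good := hM.good_init
  cover v hv := .inl (by simpa [EQdas.initConfig] using hv)
  nodup _ _ := List.nodup_nil
  mem _ _ v hv := by simp at hv
  block_eq _ _ := rfl
  edge u v := by simp [EQdas.initConfig]
  phase _ _ := .absent
  nil_iff _ _ := by simp

theorem WF.exists_inv {M : StackMachine} (hM : M.WF) {c : Config} (hc : M.sys.Reachable c) :
    ∃ ch w i m, Reaches M.step M.initCfg m ∧ M.Inv ch w i c m := by
  induction hc with
  | refl => exact ⟨_, _, _, _, .refl, hM.inv_init⟩
  | tail _ ht ih =>
    obtain ⟨ch, w, i, m, hr, h⟩ := ih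
    obtain ⟨a, ha⟩ := ht
    obtain ⟨ch', w', i', ⟨m', hs, h'⟩ | ⟨h', -⟩⟩ := h.advances hM ha
    · exact ⟨_, _, _, _, hr.tail hs, h'⟩
    · exact ⟨_, _, _, _, hr, h'⟩

/-- Induction along a halting computation of the machine: a property of configurations holds if
it is inherited from the successors by every configuration that has a successor or in which the
main task has noticed that the machine has halted. -/
theorem Inv.induction_of_halts {M : StackMachine} (hM : M.WF) {P : Config → Prop} {mf : Cfg}
    (h0 : mf.1 = 0)
    (hP : ∀ c, ((∃ a c', M.sys.Trans c a c') ∨ ∃ ch w, M.Inv ch w (M.numStk + 1) c mf) →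
      (∀ a c', M.sys.Trans c a c' → P c') → P c)
    {m : Cfg} (hr : Reaches M.step m mf) : ∀ {ch w i c}, M.Inv ch w i c m → P c := by
  -- For a fixed machine configuration, strong induction on the rank handles the bookkeeping steps;
  -- `hnext` handles the machine step. The outer induction goes backwards along the halting
  -- computation.
  have main : ∀ m : Cfg, (∀ m', M.step m = some m' → ∀ ch w i c, M.Inv ch w i c m' → P c) →
      (m.1 = 0 → m = mf) → ∀ n ch w i c, M.Inv ch w i c m → M.rank w i = n → P c := by
    intro m hnext hm n
    induction n using Nat.strong_induction_on with
    | _ n ih =>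
      intro ch w i c h hn
      refine hP c ?_ fun a c' ht => ?_
      · by_cases he : m.1 = 0 ∧ i = M.numStk + 1
        · obtain ⟨he, rfl⟩ := he
          exact .inr ⟨ch, w, hm he ▸ h⟩
        · have hle := h.le
          refine .inl (h.enabled hM ?_)
          by_cases hm0 : m.1 = 0
          · right
            have : i ≠ M.numStk + 1 := fun e => he ⟨hm0, e⟩
            omega
          · exact .inl hm0
      · obtain ⟨ch', w', i', ⟨m', hs, h'⟩ | ⟨h', hlt⟩⟩ := h.advances hM ht
        · exact hnext m' hs _ _ _ _ h'
        · exact ih _ (hn ▸ hlt) _ _ _ _ h' rfl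
  induction hr using Relation.ReflTransGen.head_induction_on with
  | refl =>
    intro ch w i c h
    exact main mf (fun m' hs => by simp [step, h0] at hs) (fun _ => rfl) _ _ _ _ _ h rfl
  | head hs _ ih =>
    intro ch w i c h
    refine main _ (fun m' hs' => ?_) (fun e => ?_) _ _ _ _ _ h rfl
    · obtain rfl := Option.some_inj.1 (hs'.symm.trans hs)
      exact fun ch w i c h => ih h
    -- A configuration with control state `0` has no successor, so it cannot be an earlier one of
    -- the computation.
    · have hs' := hs
      rw [Option.mem_def, step, if_pos e] at hs'
      simp at hs'

/-! ### Coverability and termination of the system versus halting of the machine -/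

/-- The table that asks for one vertex in the location in which the main task has noticed that
the machine has halted. -/
def target (M : StackMachine) : List (List ℕ) :=
  List.replicate M.numSym [] ++ [List.replicate (M.numStk + 1) 0 ++ [1]]

theorem tableMap_target (M : StackMachine) (s : Loc) :
    tableMap M.target s = if s = (M.numSym, M.numStk + 1) then 1 else 0 := by
  obtain ⟨γ, t⟩ := s
  simp only [tableMap, target, Prod.mk.injEq, List.getD_eq_getElem?_getD]
  rcases lt_trichotomy γ M.numSym with h | rfl | h
  · rw [List.getElem?_append_left (by simpa), if_neg (by omega)]
    simp [h]
  · simp only [List.getElem?_append_right (List.length_replicate ..).le, List.length_replicate,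
      Nat.sub_self, List.getElem?_cons_zero, Option.getD_some, true_and]
    rcases lt_trichotomy t (M.numStk + 1) with h | rfl | h
    · rw [List.getElem?_append_left (by simp only [List.length_replicate]; exact h),
        if_neg (by omega)]
      simp [h]
    · rw [List.getElem?_append_right (by simp)]
      simp
    · rw [List.getElem?_eq_none (by simp; omega), if_neg (by omega)]
      rfl
  · obtain ⟨x, rfl⟩ := Nat.exists_eq_add_of_lt h
    rw [List.getElem?_append_right (by simp only [List.length_replicate]; omega),
      if_neg (by omega)]
    simp [Nat.add_assoc]

theorem WF.parikhCoverable_iff {M : StackMachine} (hM : M.WF) :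
    M.sys.ParikhCoverable (tableMap M.target) ↔ M.Halts := by
  constructor
  · rintro ⟨c, hc, hcov⟩
    have := hcov (M.numSym, M.numStk + 1)
      ⟨by simp [sys_length], by simp [sys_block_main, mainBlock]⟩
    rw [tableMap_target, if_pos rfl] at this
    obtain ⟨v, hv⟩ := Finset.card_pos.1 this
    obtain ⟨hv, hs⟩ := Finset.mem_filter.1 hv
    obtain ⟨ch, w, i, m, hr, h⟩ := hM.exists_inv hc
    obtain rfl := h.eq_zero_of_state hv (by rw [hs])
    rw [h.main_state] at hs
    exact ⟨m, hr, h.halted (Prod.mk.inj hs).2⟩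
  · rintro ⟨mf, hr, h0⟩
    -- The property is that a covering configuration can be reached from `c`; one enabled step
    -- suffices to inherit it.
    let P : Config → Prop := fun c => ∃ c',
      Relation.ReflTransGen (fun c₁ c₂ => ∃ a, M.sys.Trans c₁ a c₂) c c' ∧
        ∀ s ∈ M.sys.locs, tableMap M.target s ≤ c'.graph.parikh s
    refine Inv.induction_of_halts hM (P := P) h0 ?_ hr hM.inv_init
    rintro c (⟨a, c', ht⟩ | ⟨ch, w, h⟩) hsucc
    · obtain ⟨c'', hr, hcov⟩ := hsucc a c' ht
      exact ⟨c'', hr.head ⟨a, ht⟩, hcov⟩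
    · refine ⟨c, .refl, fun s _ => ?_⟩
      rw [tableMap_target]
      split_ifs with hs
      · exact Finset.card_pos.2 ⟨0, Finset.mem_filter.2 ⟨h.main_mem, hs ▸ h.main_state⟩⟩
      · exact Nat.zero_le _

theorem WF.terminates_iff {M : StackMachine} (hM : M.WF) : M.sys.Terminates ↔ M.Halts := by
  constructor
  · intro hterm
    by_contra hh
    -- If the machine does not halt, each of these configurations has a successor of the same kind,
    -- and iterating a choice yields an infinite run.
    let Q : Type := {c : Config // ∃ ch w i m, Reaches M.step M.initCfg m ∧ M.Inv ch w i c m}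
    have hnext : ∀ c : Q, ∃ c' : Q, ∃ a, M.sys.Trans c.1 a c'.1 := by
      rintro ⟨c, ch, w, i, m, hr, h⟩
      obtain ⟨a, c', ht⟩ := h.enabled hM (.inl fun h0 => hh ⟨m, hr, h0⟩)
      obtain ⟨ch', w', i', ⟨m', hs, h'⟩ | ⟨h', -⟩⟩ := h.advances hM ht
      · exact ⟨⟨c', _, _, _, _, hr.tail hs, h'⟩, a, ht⟩
      · exact ⟨⟨c', _, _, _, _, hr, h'⟩, a, ht⟩
    choose next lab hlab using hnext
    let run : ℕ → Q := fun n =>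
      Nat.rec ⟨M.sys.initConfig, _, _, _, _, .refl, hM.inv_init⟩ (fun _ c => next c) n
    exact hterm ⟨fun n => (run n).1, fun n => lab (run n), rfl, fun n => hlab (run n)⟩
  · rintro ⟨mf, hr, h0⟩ ⟨c, a, hc, hrun⟩
    -- No configuration of an infinite run can be one for which the induction applies: occurrence at
    -- `j` forces occurrence of a successor at `j + 1`. The contradiction comes from index `0`.
    let P : Config → Prop := fun c₀ => ∀ j, c j ≠ c₀
    refine Inv.induction_of_halts hM (P := P) h0 ?_ hr hM.inv_init 0 hc
    rintro c₀ - hsucc j rfl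
    exact hsucc _ _ (hrun j) (j + 1) rfl

open Turing Turing.PartrecToTM2

/-! ### A stack machine that loads its input before it starts -/

/-- A stack machine with four stacks and twenty symbols that first pushes the word `L` to the stack
`0` (in the control states above `B`) and then continues in the control state `q₀ ≤ B`. -/
def loader (B q₀ : ℕ) (st : ℕ → ℕ) (nx ac : ℕ → ℕ → ℕ) (L : List ℕ) : StackMachine where
  numStk := 4
  numSym := 20
  numCtl := B + 2 + L.length
  start := B + 1 + L.length
  stk q := if q ≤ B then st q else 0
  nxt q γ := if q ≤ B then nx q γ else if q = B + 1 then q₀ else q - 1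
  act q γ := if q ≤ B then ac q γ else if q = B + 1 then 0 else L.getD (q - (B + 2)) 0 + 2

section Loader

variable {B q₀ : ℕ} {st : ℕ → ℕ} {nx ac : ℕ → ℕ → ℕ} {L : List ℕ}

theorem wf_loader (hq₀ : q₀ ≤ B) (hst : ∀ q ≤ B, st q < 4)
    (hnx : ∀ q ≤ B, ∀ γ < 20, nx q γ ≤ B)
    (hac : ∀ q ≤ B, ∀ γ < 20, γ % 4 = st q → ac q γ = 0 ∨ (ac q γ = 1 ∧ 4 ≤ γ) ∨
      ∃ γ' < 20, ac q γ = γ' + 2 ∧ γ' % 4 = γ % 4)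
    (hL : ∀ γ ∈ L, γ < 20 ∧ γ % 4 = 0) : (loader B q₀ st nx ac L).WF where
  numStk_pos := by simp [loader]
  numStk_le := by simp [loader]
  start_lt := by simp only [loader]; omega
  stk_lt q _ := by
    simp only [loader]
    split_ifs with h
    · exact hst q h
    · omega
  nxt_lt q hq γ hγ := by
    simp only [loader] at hq hγ ⊢
    split_ifs with h
    · have := hnx q h γ hγ
      omega
    · omega
    · omega
  act_ok q hq γ hγ hγ' := by
    simp only [loader] at hq hγ hγ' ⊢
    split_ifs at hγ' ⊢ with h h'
    · exact hac q h γ hγ hγ'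
    · exact .inl rfl
    · obtain ⟨h1, h2⟩ := hL (L.getD (q - (B + 2)) 0) (by
        rw [List.getD_eq_getElem _ _ (by omega)]
        exact List.getElem_mem _)
      exact .inr (.inr ⟨_, h1, rfl, h2.trans hγ'.symm⟩)

/-- The word is pushed from its last symbol to its first, so that its head ends on top. `L₂` is the
part already pushed, and the control state counts the symbols left in `L₁`. -/
theorem loader_reaches (L₂ : List ℕ) : ∀ L₁, L = L₁ ++ L₂ →
    Reaches (loader B q₀ st nx ac L).step (loader B q₀ st nx ac L).initCfg
      (B + 1 + L₁.length, Function.update (fun k => [k]) 0 (L₂ ++ [0])) := by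
  induction L₂ with
  | nil =>
    rintro L₁ rfl
    have : Function.update (fun k : ℕ => [k]) 0 ([] ++ [0]) = fun k => [k] := by
      rw [List.nil_append]
      exact Function.update_eq_self 0 _
    rw [this]
    simp only [initCfg, loader, List.append_nil]
    exact .refl
  | cons x L₂ ih =>
    rintro L₁ rfl
    have h := ih (L₁ ++ [x]) (by simp)
    refine h.tail ?_
    rw [Option.mem_def]
    set M := loader B q₀ st nx ac (L₁ ++ x :: L₂) with hM
    have hstk : M.stk (B + 1 + (L₁ ++ [x]).length) = 0 := by
      simp only [hM, loader]
      rw [if_neg (by omega)]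
    have hnxt : ∀ γ, M.nxt (B + 1 + (L₁ ++ [x]).length) γ = B + 1 + L₁.length := fun γ => by
      simp only [hM, loader, List.length_append, List.length_singleton]
      rw [if_neg (by omega), if_neg (by omega)]
      omega
    have hact : ∀ γ, M.act (B + 1 + (L₁ ++ [x]).length) γ = x + 2 := fun γ => by
      simp only [hM, loader, List.length_append, List.length_singleton]
      rw [if_neg (by omega), if_neg (by omega)]
      have : B + 1 + (L₁.length + 1) - (B + 2) = L₁.length := by omega
      simp [this]
    obtain ⟨γ, l, hl⟩ : ∃ γ l, L₂ ++ [0] = γ :: l := by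
      cases L₂ <;> exact ⟨_, _, rfl⟩
    rw [step_eq_some (γ := γ) (l := l) (by simp) (by rw [hstk]; simpa using hl), hnxt, hact, hstk]
    simp [applyAct, hl]

theorem loader_reaches_start :
    Reaches (loader B q₀ st nx ac L).step (loader B q₀ st nx ac L).initCfg
      (q₀, Function.update (fun k => [k]) 0 (L ++ [0])) := by
  refine (loader_reaches L [] rfl).tail ?_
  obtain ⟨γ, l, hl⟩ : ∃ γ l, L ++ [0] = γ :: l := by
    cases L <;> exact ⟨_, _, rfl⟩
  rw [Option.mem_def, step_eq_some (γ := γ) (l := l) (by simp) (by simpa [loader] using hl)]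
  simp [applyAct, hl, loader]

end Loader

/-! ### Simulation of the machines for partial recursive functions -/

def stackIdx : K' → ℕ
  | .main => 0
  | .rev => 1
  | .aux => 2
  | .stack => 3

def stackOf : ℕ → K'
  | 0 => .main
  | 1 => .rev
  | 2 => .aux
  | _ => .stack

def symIdx : Γ' → ℕ
  | .consₗ => 0
  | .cons => 1
  | .bit0 => 2
  | .bit1 => 3

/-- The symbol `a` on the stack `k` as a number. -/
def encSym (k : ℕ) (a : Γ') : ℕ := 4 * (symIdx a + 1) + k

def symOf (γ : ℕ) : Option Γ' :=
  match γ / 4 with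
  | 0 => none
  | 1 => some .consₗ
  | 2 => some .cons
  | 3 => some .bit0
  | _ => some .bit1

theorem stackIdx_lt (k : K') : stackIdx k < 4 := by cases k <;> simp [stackIdx]

theorem stackOf_stackIdx (k : K') : stackOf (stackIdx k) = k := by cases k <;> rfl

theorem stackIdx_stackOf {j : ℕ} (h : j < 4) : stackIdx (stackOf j) = j := by
  interval_cases j <;> rfl

theorem encSym_lt {k : ℕ} (hk : k < 4) (a : Γ') : encSym k a < 20 := by
  cases a <;> simp only [encSym, symIdx] <;> omega

theorem encSym_mod {k : ℕ} (hk : k < 4) (a : Γ') : encSym k a % 4 = k := by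
  simp only [encSym]; omega

theorem symOf_encSym {k : ℕ} (hk : k < 4) (a : Γ') : symOf (encSym k a) = some a := by
  have : encSym k a / 4 = symIdx a + 1 := by simp only [encSym]; omega
  rw [symOf, this]
  cases a <;> rfl

theorem symOf_bot {k : ℕ} (hk : k < 4) : symOf k = none := by
  have : k / 4 = 0 := by omega
  rw [symOf, this]
  rfl

theorem le_of_symOf_isSome {γ : ℕ} (h : (symOf γ).isSome) : 4 ≤ γ := by
  by_contra hlt
  rw [symOf_bot (by omega)] at h
  simp at h

/-- Beyond the four stacks the value `[j]` agrees with `initCfg`, so encoded and loaded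
configurations can be equal as functions. -/
def encStk (S : K' → List Γ') (j : ℕ) : List ℕ :=
  if j < 4 then (S (stackOf j)).map (encSym j) ++ [j] else [j]

theorem encStk_stackIdx (S : K' → List Γ') (k : K') :
    encStk S (stackIdx k) = (S k).map (encSym (stackIdx k)) ++ [stackIdx k] := by
  rw [encStk, if_pos (stackIdx_lt k), stackOf_stackIdx]

theorem encStk_update (S : K' → List Γ') (k : K') (l : List Γ') :
    encStk (Function.update S k l) =
      Function.update (encStk S) (stackIdx k) (l.map (encSym (stackIdx k)) ++ [stackIdx k]) := by
  funext j
  by_cases hj : j = stackIdx k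
  · subst hj
    simp [encStk_stackIdx]
  · rw [Function.update_of_ne hj, encStk, encStk]
    split_ifs with h
    · have : stackOf j ≠ k := by
        rintro rfl
        exact hj (stackIdx_stackOf h).symm
      rw [Function.update_of_ne this]
    · rfl

/-- The top of a stack. -/
theorem exists_encStk_eq_cons (S : K' → List Γ') (k : K') : ∃ γ l,
    encStk S (stackIdx k) = γ :: l ∧ symOf γ = (S k).head? ∧ γ < 20 ∧
      ((S k).head?.isSome → l = ((S k).tail).map (encSym (stackIdx k)) ++ [stackIdx k]) := by
  have hk := stackIdx_lt k
  rw [encStk_stackIdx]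
  cases S k with
  | nil => exact ⟨_, _, rfl, symOf_bot hk, by omega, by simp⟩
  | cons a l => exact ⟨_, _, rfl, symOf_encSym hk a, encSym_lt hk a, fun _ => rfl⟩

/-- The statements of the simulated machine. -/
abbrev Stm := TM2.Stmt (fun _ : K' => Γ') Λ' (Option Γ')

/-- A control state of the simulation: the statement that is to be executed and the store. -/
abbrev Ctl := Stm × Option Γ'

def ctlStack : Stm → K'
  | .push k _ _ => k
  | .peek k _ _ => k
  | .pop k _ _ => k
  | _ => .main

/-- The next control state and the action on the stack, given the top of the stack. -/
def ctlStep (v : Option Γ') (o : Option Γ') : Stm → Option Ctl × ℕ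
  | .push k f s => (some (s, v), encSym (stackIdx k) (f v) + 2)
  | .peek _ f s => (some (s, f v o), 0)
  | .pop _ f s => (some (s, f v o), o.elim 0 fun _ => 1)
  | .load f s => (some (s, f v), 0)
  | .branch f s₁ s₂ => (some (cond (f v) s₁ s₂, v), 0)
  | .goto f => (some (tr (f v), v), 0)
  | .halt => (none, 0)

/-- A pop on an empty simulated stack becomes the action that keeps the bottom, so only proper
symbols are popped. -/
theorem ctlStep_act (v : Option Γ') (γ : ℕ) (s : Stm) (hγ : γ % 4 = stackIdx (ctlStack s)) :
    (ctlStep v (symOf γ) s).2 = 0 ∨ ((ctlStep v (symOf γ) s).2 = 1 ∧ 4 ≤ γ) ∨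
      ∃ γ' < 20, (ctlStep v (symOf γ) s).2 = γ' + 2 ∧ γ' % 4 = γ % 4 := by
  cases s with
  | push k f s =>
    have hk := stackIdx_lt k
    exact .inr (.inr ⟨_, encSym_lt hk _, rfl, (encSym_mod hk _).trans hγ.symm⟩)
  | pop k f s =>
    simp only [ctlStep]
    cases h : symOf γ with
    | none => exact .inl rfl
    | some a => exact .inr (.inl ⟨rfl, le_of_symOf_isSome (by simp [h])⟩)
  | _ => exact .inl rfl

/-- The elements of a finite set can be numbered by positive numbers. -/
theorem exists_numbering {α : Type*} (F : Finset α) : ∃ (num : α → ℕ) (elt : ℕ → Option α),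
    (∀ p, num p ≤ F.card) ∧ ∀ p ∈ F, num p ≠ 0 ∧ elt (num p) = some p := by
  classical
  refine ⟨fun p => if p ∈ F then F.toList.idxOf p + 1 else 0, fun q => F.toList[q - 1]?,
    fun p => ?_, fun p hp => ?_⟩
  · dsimp only
    split_ifs with hp
    · have := List.idxOf_lt_length_of_mem (Finset.mem_toList.2 hp)
      rw [Finset.length_toList] at this
      omega
    · exact Nat.zero_le _
  · have := Finset.mem_toList.2 hp
    simp [hp, List.getElem?_eq_getElem (List.idxOf_lt_length_of_mem this)]

section Simulation

variable {num : Ctl → ℕ} {elt : ℕ → Option Ctl} {B : ℕ}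

def numStack (elt : ℕ → Option Ctl) (q : ℕ) : ℕ :=
  (elt q).elim 0 fun p => stackIdx (ctlStack p.1)

/-- A missing successor gets the number `0`, the halting control state, which `exists_numbering`
keeps free. -/
def numNext (num : Ctl → ℕ) (elt : ℕ → Option Ctl) (q γ : ℕ) : ℕ :=
  (elt q).elim 0 fun p => (ctlStep p.2 (symOf γ) p.1).1.elim 0 num

def numAct (elt : ℕ → Option Ctl) (q γ : ℕ) : ℕ :=
  (elt q).elim 0 fun p => (ctlStep p.2 (symOf γ) p.1).2

/-- The machine behaves like the numbered control states. -/
structure Simulates (M : StackMachine) (num : Ctl → ℕ) (elt : ℕ → Option Ctl) (B : ℕ) : Prop where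
  stk : ∀ q ≤ B, M.stk q = numStack elt q
  nxt : ∀ q ≤ B, ∀ γ < 20, M.nxt q γ = numNext num elt q γ
  act : ∀ q ≤ B, ∀ γ < 20, M.act q γ = numAct elt q γ

theorem Simulates.step_eq {M : StackMachine} (hM : M.Simulates num elt B) {s : Stm}
    {v : Option Γ'} (hB : num (s, v) ≤ B) (h0 : num (s, v) ≠ 0)
    (helt : elt (num (s, v)) = some (s, v)) (S : K' → List Γ') :
    ∃ γ l, encStk S (stackIdx (ctlStack s)) = γ :: l ∧
      ((S (ctlStack s)).head?.isSome →
        l = ((S (ctlStack s)).tail).map (encSym (stackIdx (ctlStack s))) ++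
          [stackIdx (ctlStack s)]) ∧
      M.step (num (s, v), encStk S) =
        some ((ctlStep v (S (ctlStack s)).head? s).1.elim 0 num,
          Function.update (encStk S) (stackIdx (ctlStack s))
            (applyAct (ctlStep v (S (ctlStack s)).head? s).2 γ l)) := by
  obtain ⟨γ, l, hl, hγ, hlt, htail⟩ := exists_encStk_eq_cons S (ctlStack s)
  have hstk : M.stk (num (s, v)) = stackIdx (ctlStack s) := by
    rw [hM.stk _ hB, numStack, helt]
    rfl
  refine ⟨γ, l, hl, htail, ?_⟩
  rw [step_eq_some (γ := γ) (l := l) h0 (by rw [hstk]; exact hl), hstk, hM.nxt _ hB _ hlt,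
    hM.act _ hB _ hlt, numNext, numAct, helt, ← hγ]
  rfl

/-- The configuration that represents a configuration of the simulated machine. -/
def encCfg (num : Ctl → ℕ) (c : Cfg') : Cfg :=
  (c.l.elim 0 fun l => num (tr l, c.var), encStk c.stk)

/-- One step of a `TM2` machine executes a whole statement; the stack machine spends one step on
each constructor passed. The set `T` is closed under substatements, so every intermediate control
state is properly numbered. -/
theorem Simulates.reaches_stepAux {M : StackMachine} (hM : M.Simulates num elt B)
    {T : Finset (Option Stm)}
    (hnum : ∀ s v, some s ∈ T →
      num (s, v) ≤ B ∧ num (s, v) ≠ 0 ∧ elt (num (s, v)) = some (s, v))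
    (hT : ∀ s s' : Stm, s' ∈ TM2.stmts₁ s → some s ∈ T → some s' ∈ T) (s : Stm) :
    ∀ v S, some s ∈ T →
      Reaches₁ M.step (num (s, v), encStk S) (encCfg num (TM2.stepAux s v S)) := by
  classical
  induction s with
  | push k f s ih =>
    intro v S hs
    obtain ⟨h1, h2, h3⟩ := hnum _ v hs
    obtain ⟨γ, l, hl, -, hstep⟩ := hM.step_eq h1 h2 h3 S
    refine .head hstep ?_
    have := ih v (Function.update S k (f v :: S k))
      (hT _ _ (by unfold TM2.stmts₁; exact Finset.mem_insert_of_mem TM2.stmts₁_self) hs)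
    rw [encStk_update, List.map_cons, List.cons_append, ← encStk_stackIdx] at this
    simp only [ctlStack] at hl
    rw [hl] at this
    exact this
  | peek k f s ih =>
    intro v S hs
    obtain ⟨h1, h2, h3⟩ := hnum _ v hs
    obtain ⟨γ, l, hl, -, hstep⟩ := hM.step_eq h1 h2 h3 S
    refine .head hstep ?_
    have := ih (f v (S k).head?) S (hT _ _ (by unfold TM2.stmts₁; exact Finset.mem_insert_of_mem TM2.stmts₁_self) hs)
    simp only [ctlStack, ctlStep, applyAct] at hl ⊢
    rw [← hl, Function.update_eq_self]
    exact this
  | pop k f s ih =>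
    intro v S hs
    obtain ⟨h1, h2, h3⟩ := hnum _ v hs
    obtain ⟨γ, l, hl, htl, hstep⟩ := hM.step_eq h1 h2 h3 S
    refine .head hstep ?_
    have := ih (f v (S k).head?) (Function.update S k (S k).tail)
      (hT _ _ (by unfold TM2.stmts₁; exact Finset.mem_insert_of_mem TM2.stmts₁_self) hs)
    rw [encStk_update] at this
    simp only [ctlStack] at hl htl
    change Relation.TransGen _ (num (s, f v (S k).head?), Function.update (encStk S) (stackIdx k)
      (applyAct ((S k).head?.elim 0 fun _ => 1) γ l)) _
    rw [TM2.stepAux.eq_3]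
    cases hS : S k with
    | cons a r =>
      rw [htl (by simp [hS]), hS]
      rw [hS] at this
      exact this
    -- Here the kept bottom matches `List.tail` of the empty list.
    | nil =>
      change Relation.TransGen _ (_, Function.update (encStk S) (stackIdx k) (γ :: l)) _
      rw [← hl, Function.update_eq_self]
      rw [hS, List.tail_nil, ← hS, ← encStk_stackIdx, Function.update_eq_self] at this
      rw [hS] at this
      exact this
  | load f s ih =>
    intro v S hs
    obtain ⟨h1, h2, h3⟩ := hnum _ v hs
    obtain ⟨γ, l, hl, -, hstep⟩ := hM.step_eq h1 h2 h3 S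
    refine .head hstep ?_
    have := ih (f v) S (hT _ _ (by unfold TM2.stmts₁; exact Finset.mem_insert_of_mem TM2.stmts₁_self) hs)
    simp only [ctlStack, ctlStep, applyAct] at hl ⊢
    rw [← hl, Function.update_eq_self]
    exact this
  | branch f s₁ s₂ ih₁ ih₂ =>
    intro v S hs
    obtain ⟨h1, h2, h3⟩ := hnum _ v hs
    obtain ⟨γ, l, hl, -, hstep⟩ := hM.step_eq h1 h2 h3 S
    refine .head hstep ?_
    have t1 := ih₁ v S (hT _ _ (by
      unfold TM2.stmts₁
      exact Finset.mem_insert_of_mem (Finset.mem_union_left _ TM2.stmts₁_self)) hs)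
    have t2 := ih₂ v S (hT _ _ (by
      unfold TM2.stmts₁
      exact Finset.mem_insert_of_mem (Finset.mem_union_right _ TM2.stmts₁_self)) hs)
    simp only [ctlStack, ctlStep, applyAct] at hl ⊢
    rw [← hl, Function.update_eq_self, TM2.stepAux.eq_5]
    cases f v
    · exact t2
    · exact t1
  | goto f =>
    intro v S hs
    obtain ⟨h1, h2, h3⟩ := hnum _ v hs
    obtain ⟨γ, l, hl, -, hstep⟩ := hM.step_eq h1 h2 h3 S
    refine .single ?_
    rw [Option.mem_def, hstep]
    simp only [ctlStack, ctlStep, applyAct] at hl ⊢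
    rw [← hl, Function.update_eq_self]
    rfl
  | halt =>
    intro v S hs
    obtain ⟨h1, h2, h3⟩ := hnum _ v hs
    obtain ⟨γ, l, hl, -, hstep⟩ := hM.step_eq h1 h2 h3 S
    refine .single ?_
    rw [Option.mem_def, hstep]
    simp only [ctlStack, ctlStep, applyAct] at hl ⊢
    rw [← hl, Function.update_eq_self]
    rfl

/-- For every code there is a finite table that simulates it. -/
theorem exists_simulation (c : ToPartrec.Code) :
    ∃ (num : Ctl → ℕ) (elt : ℕ → Option Ctl) (B : ℕ), (∀ p, num p ≤ B) ∧
      ∀ M : StackMachine, M.Simulates num elt B → ∀ v,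
        ((eval M.step (encCfg num (init c v))).Dom ↔ (c.eval v).Dom) := by
  classical
  -- `TM2.Supports` requires the default label to lie in the support, so the default is taken to be
  -- the start label.
  let : Inhabited Λ' := ⟨trNormal c .halt⟩
  have hsup : TM2.Supports tr (codeSupp c .halt) := tr_supports c .halt
  set Q := codeSupp c .halt
  obtain ⟨num, elt, hB, hnum⟩ := exists_numbering
    ((TM2.stmts tr Q).eraseNone ×ˢ (Finset.univ : Finset (Option Γ')))
  refine ⟨num, elt, _, hB, fun M hM v => ?_⟩
  have hstmt : ∀ l ∈ Q, some (tr l) ∈ TM2.stmts tr Q := fun l hl => by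
    refine Finset.some_mem_insertNone.2 (Finset.mem_biUnion.2 ⟨l, hl, TM2.stmts₁_self⟩)
  -- The relation also demands that the label stay in the finite support, because only control
  -- states from there are numbered faithfully.
  have hresp : Respects (TM2.step tr) M.step
      fun (a : Cfg') (b : Cfg) => a.l ∈ Finset.insertNone Q ∧ b = encCfg num a := by
    rintro ⟨l, x, S⟩ b ⟨hl, rfl⟩
    rcases l with - | l
    · exact if_pos rfl
    · have hl' := Finset.some_mem_insertNone.1 hl
      refine ⟨_, ⟨TM2.step_supports tr hsup (c := ⟨some l, x, S⟩) rfl hl, rfl⟩, ?_⟩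
      exact hM.reaches_stepAux
        (fun s v hs => ⟨hB _, hnum _ (Finset.mem_product.2 ⟨Finset.mem_eraseNone.2 hs, Finset.mem_univ _⟩)⟩)
        (fun s s' h1 h2 => TM2.stmts_trans h1 h2) (tr l) x S (hstmt l hl')
  rw [tr_eval_dom hresp (a₁ := init c v) ⟨Finset.some_mem_insertNone.2 hsup.1, rfl⟩,
    PartrecToTM2.tr_eval]
  rfl

end Simulation

/-! ### The reduction is computable -/

/-- The numbering of control states comes from choice and carries no computability, but only
finitely many values matter, and a lookup in a constant table is primitive recursive. -/
theorem exists_primrec_agree (f : ℕ → ℕ → ℕ) (a b : ℕ) :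
    ∃ g : ℕ → ℕ → ℕ, Primrec₂ g ∧ ∀ q ≤ a, ∀ γ < b, g q γ = f q γ := by
  let T : List (List ℕ) := (List.range (a + 1)).map fun q => (List.range b).map (f q)
  refine ⟨fun q γ => (T.getD q []).getD γ 0,
    (Primrec.list_getD 0).comp ((Primrec.list_getD []).comp (Primrec.const T) Primrec.fst)
      Primrec.snd, fun q hq γ hγ => ?_⟩
  simp [T, List.getD_eq_getElem?_getD, Nat.lt_succ_of_le hq, hγ]

/-- The binary representation of a number, as symbols of the stack `0`. -/
def digits (n : ℕ) : List ℕ :=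
  if n = 0 then [] else encSym 0 (if n % 2 = 0 then .bit0 else .bit1) :: digits (n / 2)

theorem map_trPosNum (p : PosNum) : (trPosNum p).map (encSym 0) = digits p := by
  induction p with
  | one =>
    rw [digits, digits]
    simp [trPosNum]
  | bit0 p ih =>
    have hp : 0 < (p : ℕ) := p.cast_pos
    rw [digits, if_neg (by rw [PosNum.cast_bit0]; omega)]
    have h1 : ((p.bit0 : PosNum) : ℕ) % 2 = 0 := by rw [PosNum.cast_bit0]; omega
    have h2 : ((p.bit0 : PosNum) : ℕ) / 2 = p := by rw [PosNum.cast_bit0]; omega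
    rw [h1, h2, trPosNum, List.map_cons, ih]
    rfl
  | bit1 p ih =>
    have hp : 0 < (p : ℕ) := p.cast_pos
    rw [digits, if_neg (by rw [PosNum.cast_bit1]; omega)]
    have h1 : ((p.bit1 : PosNum) : ℕ) % 2 = 1 := by rw [PosNum.cast_bit1]; omega
    have h2 : ((p.bit1 : PosNum) : ℕ) / 2 = p := by rw [PosNum.cast_bit1]; omega
    rw [h1, h2, trPosNum, List.map_cons, ih]
    rfl

theorem map_trNat (n : ℕ) : (trNat n).map (encSym 0) = digits n := by
  rw [trNat]
  conv_rhs => rw [← Num.to_of_nat n]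
  cases (n : Num) with
  | zero =>
    rw [digits]
    rfl
  | pos p => exact map_trPosNum p

theorem primrec_digits : Primrec digits := by
  have h : Primrec₂ fun (_ : Unit) (n : ℕ) => digits n := by
    refine Primrec.nat_strong_rec _ (g := fun _ l => some (if l.length = 0 then [] else
      (if l.length % 2 = 0 then encSym 0 .bit0 else encSym 0 .bit1) ::
        l.getD (l.length / 2) [])) ?_ fun _ n => ?_
    · have hlen : Primrec fun p : Unit × List (List ℕ) => p.2.length :=
        Primrec.list_length.comp Primrec.snd
      refine Primrec.option_some.comp (Primrec.ite
        (Primrec.eq.comp hlen (Primrec.const 0)) (Primrec.const [])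
        (Primrec.list_cons.comp (Primrec.ite
          (Primrec.eq.comp (Primrec.nat_mod.comp hlen (Primrec.const 2)) (Primrec.const 0))
          (Primrec.const _) (Primrec.const _))
        ((Primrec.list_getD []).comp Primrec.snd
          (Primrec.nat_div.comp hlen (Primrec.const 2)))))
    · rw [digits]
      by_cases hn : n = 0
      · simp [hn]
      · have : n / 2 < n := by omega
        simp only [List.length_map, List.length_range, if_neg hn, List.getD_eq_getElem?_getD,
          List.getElem?_map, List.getElem?_range this, Option.map_some, Option.getD_some]
        split_ifs <;> rfl
  exact h.comp (Primrec.const ()) Primrec.id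

/-- The input `n` as a word of stack symbols. -/
def inputWord (n : ℕ) : List ℕ := digits n ++ [encSym 0 .cons]

theorem map_trList (n : ℕ) : (trList [n]).map (encSym 0) = inputWord n := by
  simp [inputWord, map_trNat]

theorem primrec_inputWord : Primrec inputWord :=
  Primrec.list_append.comp primrec_digits (Primrec.const _)

section SysPrimrec

variable {α : Type} [Primcodable α]

theorem primrec_guard {f : α → ℕ} (hf : Primrec f) :
    Primrec fun a => Action.guard [.eq 0 (f a)] := by
  have h1 : Primrec fun a => Atom.eq 0 (f a) :=
    (Primrec.of_equiv_symm (e := atomEquiv)).comp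
      (Primrec.sumInl.comp ((Primrec.const 0).pair hf))
  exact (Primrec.of_equiv_symm (e := actionEquiv)).comp (Primrec.sumInr.comp
    (Primrec.sumInr.comp (Primrec.sumInl.comp (Primrec.list_cons.comp h1 (Primrec.const [])))))

theorem primrec_assign {f : α → ℕ} (hf : Primrec f) :
    Primrec fun a => Action.assign 0 (f a) :=
  (Primrec.of_equiv_symm (e := actionEquiv)).comp (Primrec.sumInr.comp
    (Primrec.sumInr.comp (Primrec.sumInr.comp ((Primrec.const 0).pair hf))))

theorem primrec_forkjoin {f g : α → ℕ} (hf : Primrec f) (hg : Primrec g) :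
    Primrec fun a => Action.forkjoin (f a) (g a) (some 1) :=
  (Primrec.of_equiv_symm (e := actionEquiv)).comp (Primrec.sumInr.comp
    (Primrec.sumInl.comp (hf.pair (hg.pair (Primrec.const _)))))

variable {M : α → StackMachine}

theorem primrec_ctlTrans {k s : ℕ} (hk : ∀ a, (M a).numStk = k) (hs : ∀ a, (M a).numSym = s)
    (hstk : Primrec₂ fun a q => (M a).stk q)
    (hnxt : Primrec fun p : (α × ℕ) × ℕ => (M p.1.1).nxt p.2 p.1.2)
    (hact : Primrec fun p : (α × ℕ) × ℕ => (M p.1.1).act p.2 p.1.2) :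
    Primrec₂ fun (p : α × ℕ) q => (M p.1).ctlTrans p.2 q := by
  have hq : Primrec fun p : (α × ℕ) × ℕ => p.2 := Primrec.snd
  have hγ : Primrec fun p : (α × ℕ) × ℕ => p.1.2 := Primrec.snd.comp Primrec.fst
  have hqs : Primrec fun p : (α × ℕ) × ℕ => p.2 + (s + 2) :=
    Primrec.nat_add.comp hq (Primrec.const _)
  have h : Primrec fun p : (α × ℕ) × ℕ =>
      if p.2 ≠ 0 ∧ p.1.2 % k = (M p.1.1).stk p.2 then
        [(0, Action.guard [.eq 0 p.2], p.2 + (s + 2)),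
          (p.2 + (s + 2), Action.assign 0 ((M p.1.1).nxt p.2 p.1.2), (M p.1.1).act p.2 p.1.2)]
      else [] :=
    Primrec.ite (PrimrecPred.and (PrimrecPred.not (Primrec.eq.comp hq (Primrec.const 0)))
        (Primrec.eq.comp (Primrec.nat_mod.comp hγ (Primrec.const k))
          (hstk.comp (Primrec.fst.comp Primrec.fst) hq)))
      (Primrec.list_cons.comp ((Primrec.const 0).pair ((primrec_guard hq).pair hqs))
        (Primrec.list_cons.comp (hqs.pair ((primrec_assign hnxt).pair hact)) (Primrec.const [])))
      (Primrec.const [])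
  refine h.of_eq fun p => ?_
  simp only [ctlTrans, hk, hs]

theorem primrec_symBlock {k s : ℕ} (hk : ∀ a, (M a).numStk = k) (hs : ∀ a, (M a).numSym = s)
    (hctl : Primrec fun a => (M a).numCtl)
    (hstk : Primrec₂ fun a q => (M a).stk q)
    (hnxt : Primrec fun p : (α × ℕ) × ℕ => (M p.1.1).nxt p.2 p.1.2)
    (hact : Primrec fun p : (α × ℕ) × ℕ => (M p.1.1).act p.2 p.1.2) :
    Primrec₂ fun a γ => (M a).symBlock γ := by
  have hfork : Primrec₂ fun (p : α × ℕ) (γ' : ℕ) =>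
      (γ' + 2, Action.forkjoin (p.2 % k) γ' (some 1), 0) :=
    (Primrec.nat_add.comp Primrec.snd (Primrec.const 2)).pair
      ((primrec_forkjoin
        (Primrec.nat_mod.comp (Primrec.snd.comp Primrec.fst) (Primrec.const k))
        Primrec.snd).pair (Primrec.const 0))
  have htrans : Primrec fun p : α × ℕ =>
      (List.range (M p.1).numCtl).flatMap ((M p.1).ctlTrans p.2) ++
        (List.range s).map fun γ' => (γ' + 2, Action.forkjoin (p.2 % k) γ' (some 1), 0) :=
    Primrec.list_append.comp
      (Primrec.list_flatMap (Primrec.list_range.comp (hctl.comp Primrec.fst))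
        (primrec_ctlTrans hk hs hstk hnxt hact))
      (Primrec.list_map (Primrec.const _) hfork)
  have hblock : Primrec fun p : α × ℕ => blockEquiv.symm ((M p.1).numCtl + (s + 2), 0, 1,
      (List.range (M p.1).numCtl).flatMap ((M p.1).ctlTrans p.2) ++
        (List.range s).map fun γ' => (γ' + 2, Action.forkjoin (p.2 % k) γ' (some 1), 0)) :=
    (Primrec.of_equiv_symm (e := blockEquiv)).comp
      ((Primrec.nat_add.comp (hctl.comp Primrec.fst) (Primrec.const _)).pair
        ((Primrec.const 0).pair ((Primrec.const 1).pair htrans)))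
  refine hblock.of_eq fun p => ?_
  simp only [symBlock, hk, hs]
  rfl

theorem primrec_sys {k s : ℕ} (hk : ∀ a, (M a).numStk = k) (hs : ∀ a, (M a).numSym = s)
    (hctl : Primrec fun a => (M a).numCtl) (hstart : Primrec fun a => (M a).start)
    (hstk : Primrec₂ fun a q => (M a).stk q)
    (hnxt : Primrec fun p : (α × ℕ) × ℕ => (M p.1.1).nxt p.2 p.1.2)
    (hact : Primrec fun p : (α × ℕ) × ℕ => (M p.1.1).act p.2 p.1.2) :
    Primrec fun a => (M a).sys := by
  -- The main block depends only on the number of stacks, so a dummy machine shows that it is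
  -- constant in the parameter.
  let mainB : Block := mainBlock ⟨k, s, 0, 0, fun _ => 0, fun _ _ => 0, fun _ _ => 0⟩
  have h : Primrec fun a => eqdasEquiv.symm ((M a).numCtl, (M a).start, k, 1, s,
      (List.range s).map (M a).symBlock ++ [mainB]) :=
    (Primrec.of_equiv_symm (e := eqdasEquiv)).comp
      (hctl.pair (hstart.pair ((Primrec.const k).pair ((Primrec.const 1).pair
        ((Primrec.const s).pair (Primrec.list_append.comp
          (Primrec.list_map (Primrec.const _) (primrec_symBlock hk hs hctl hstk hnxt hact))
          (Primrec.const _)))))))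
  refine h.of_eq fun a => ?_
  rw [sys, hk, hs, mainBlock, hk]
  rfl

end SysPrimrec

theorem primrec_sys_loader {B q₀ : ℕ} {st : ℕ → ℕ} {nx ac : ℕ → ℕ → ℕ} {L : ℕ → List ℕ}
    (hst : Primrec st) (hnx : Primrec₂ nx) (hac : Primrec₂ ac) (hL : Primrec L) :
    Primrec fun n => (loader B q₀ st nx ac (L n)).sys := by
  have hlen : Primrec fun n => (L n).length := Primrec.list_length.comp hL
  have hq : Primrec fun p : (ℕ × ℕ) × ℕ => p.2 := Primrec.snd
  have hγ : Primrec fun p : (ℕ × ℕ) × ℕ => p.1.2 := Primrec.snd.comp Primrec.fst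
  have hn : Primrec fun p : (ℕ × ℕ) × ℕ => p.1.1 := Primrec.fst.comp Primrec.fst
  refine primrec_sys (k := 4) (s := 20) (fun _ => rfl) (fun _ => rfl)
    (Primrec.nat_add.comp (Primrec.const _) hlen) (Primrec.nat_add.comp (Primrec.const _) hlen)
    ?_ ?_ ?_
  · exact Primrec.ite (Primrec.nat_le.comp Primrec.snd (Primrec.const B))
      (hst.comp Primrec.snd) (Primrec.const 0)
  · exact Primrec.ite (Primrec.nat_le.comp hq (Primrec.const B)) (hnx.comp hq hγ)
      (Primrec.ite (Primrec.eq.comp hq (Primrec.const (B + 1))) (Primrec.const q₀)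
        (Primrec.nat_sub.comp hq (Primrec.const 1)))
  · exact Primrec.ite (Primrec.nat_le.comp hq (Primrec.const B)) (hac.comp hq hγ)
      (Primrec.ite (Primrec.eq.comp hq (Primrec.const (B + 1))) (Primrec.const 0)
        (Primrec.nat_add.comp ((Primrec.list_getD 0).comp (hL.comp hn)
          (Primrec.nat_sub.comp hq (Primrec.const (B + 2)))) (Primrec.const 2)))

/-! ### Machines for partial recursive functions -/

theorem digits_ok (n : ℕ) : ∀ γ ∈ digits n, γ < 20 ∧ γ % 4 = 0 := by
  rw [← map_trNat]
  intro γ hγ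
  obtain ⟨a, -, rfl⟩ := List.mem_map.1 hγ
  exact ⟨encSym_lt (by omega) a, encSym_mod (by omega) a⟩

/-- Every partial recursive function has a primitive recursive family of stack machines that halt
exactly on the domain of the function. -/
theorem exists_halts_iff {f : ℕ →. ℕ} (hf : Partrec f) :
    ∃ M : ℕ → StackMachine, (∀ n, (M n).WF) ∧ (Primrec fun n => (M n).sys) ∧
      (∃ T, ∀ n, (M n).target = T) ∧ ∀ n, (M n).Halts ↔ (f n).Dom := by
  obtain ⟨c, hc⟩ := ToPartrec.Code.exists_code (Nat.Partrec'.part_iff₁.2 hf)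
  obtain ⟨num, elt, B, hB, hsim⟩ := exists_simulation c
  obtain ⟨st, hst, hst'⟩ := exists_primrec_agree (fun q _ => numStack elt q) B 1
  obtain ⟨nx, hnx, hnx'⟩ := exists_primrec_agree (numNext num elt) B 20
  obtain ⟨ac, hac, hac'⟩ := exists_primrec_agree (numAct elt) B 20
  have hst' : ∀ q ≤ B, st q 0 = numStack elt q := fun q hq => hst' q hq 0 one_pos
  set q₀ := num (tr (trNormal c .halt), none) with hq₀
  have hwf : ∀ n, (loader B q₀ (fun q => st q 0) nx ac (inputWord n)).WF := by
    intro n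
    refine wf_loader (hB _) (fun q hq => ?_) (fun q hq γ hγ => ?_) (fun q hq γ hγ hmod => ?_) ?_
    · rw [hst' q hq, numStack]
      cases elt q with
      | none => exact Nat.zero_lt_succ _
      | some p => exact stackIdx_lt _
    · rw [hnx' q hq γ hγ, numNext]
      cases elt q with
      | none => exact Nat.zero_le _
      | some p =>
        simp only [Option.elim_some]
        cases (ctlStep p.2 (symOf γ) p.1).1 with
        | none => exact Nat.zero_le _
        | some p' => exact hB p'
    · rw [hst' q hq, numStack] at hmod
      rw [hac' q hq γ hγ, numAct]
      cases h : elt q with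
      | none => exact .inl rfl
      | some p =>
        rw [h] at hmod
        exact ctlStep_act _ _ _ hmod
    · intro γ hγ
      rcases List.mem_append.1 hγ with hγ | hγ
      · exact digits_ok n γ hγ
      · rw [List.mem_singleton.1 hγ]
        exact ⟨encSym_lt (by omega) _, encSym_mod (by omega) _⟩
  refine ⟨fun n => loader B q₀ (fun q => st q 0) nx ac (inputWord n), hwf,
    primrec_sys_loader (hst.comp Primrec.id (Primrec.const 0)) hnx hac primrec_inputWord,
    -- The target table depends only on the numbers of stacks and symbols, so the empty input word
    -- gives the same table as `inputWord n`.
    ⟨(loader B q₀ (fun q => st q 0) nx ac []).target, fun _ => rfl⟩, fun n => ?_⟩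
  rw [← (hwf n).eval_dom_iff, reaches_eval loader_reaches_start]
  have hinit : (q₀, Function.update (fun k => [k]) 0 (inputWord n ++ [0])) =
      encCfg num (init c [n]) := by
    refine Prod.ext rfl ?_
    have h1 : (K'.elim (trList [n]) [] [] [] : K' → List Γ') =
        Function.update (fun _ => []) .main (trList [n]) := by
      funext k
      cases k <;> rfl
    have h2 : encStk (fun _ => []) = fun k => [k] := by
      funext j
      simp [encStk]
    change _ = encStk (K'.elim (trList [n]) [] [] [])
    rw [h1, encStk_update, h2, ← map_trList]
    rfl
  rw [hinit, hsim _ ⟨fun q hq => ?_, fun q hq γ hγ => ?_, fun q hq γ hγ => ?_⟩]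
  · have := hc ⟨[n], rfl⟩
    change c.eval [n] = _ at this
    rw [this]
    rfl
  · simpa [loader, hq] using hst' q hq
  · simpa [loader, hq] using hnx' q hq γ hγ
  · simpa [loader, hq] using hac' q hq γ hγ

/-! ### The undecidable source problem and the transfer -/

/-- A partial recursive function with undecidable domain. -/
theorem exists_partrec_not_computablePred_dom :
    ∃ f : ℕ →. ℕ, Partrec f ∧ ¬ ComputablePred fun n => (f n).Dom := by
  refine ⟨fun n => (Denumerable.ofNat Nat.Partrec.Code n).eval 0,
    Nat.Partrec.Code.eval_part.comp (Computable.ofNat _) (Computable.const 0), fun h => ?_⟩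
  obtain ⟨g, hg, he⟩ := ComputablePred.computable_iff.1 h
  refine ComputablePred.halting_problem 0 (ComputablePred.computable_iff.2
    ⟨fun c => g (Encodable.encode c), hg.comp Computable.encode, ?_⟩)
  funext c
  have := congrFun he (Encodable.encode c)
  simpa using this

end StackMachine

/-- A problem to which a set that is not decidable can be reduced is not decidable. -/
theorem not_decidableProblem_of_reduction {α : Type} [Primcodable α] {inst P : α → Prop}
    {p : ℕ → Prop} (hp : ¬ ComputablePred p) {g : ℕ → α} (hg : Computable g)
    (hinst : ∀ n, inst (g n)) (h : ∀ n, P (g n) ↔ p n) : ¬ DecidableProblem inst P := by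
  rintro ⟨alg, halg, hcorrect⟩
  refine hp (ComputablePred.computable_iff.2 ⟨fun n => alg (g n), halg.comp hg, ?_⟩)
  funext n
  exact propext ((h n).symm.trans (hcorrect _ (hinst n)).symm)

end QueueDispatch

theorem theorem7 :
    ¬ QueueDispatch.ExtendedParikhCoverabilityDecidable ∧
      ¬ QueueDispatch.ExtendedTerminationDecidable := by
  obtain ⟨f, hf, hdom⟩ := QueueDispatch.StackMachine.exists_partrec_not_computablePred_dom
  obtain ⟨M, hwf, hsys, ⟨T, hT⟩, hM⟩ := QueueDispatch.StackMachine.exists_halts_iff hf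
  constructor
  · refine QueueDispatch.not_decidableProblem_of_reduction hdom
      (g := fun n => ((M n).sys, T)) (hsys.pair (Primrec.const T)).to_comp
      (fun n => (hwf n).sys_valid) fun n => ?_
    rw [← hT n]
    exact (hwf n).parikhCoverable_iff.trans (hM n)
  · exact QueueDispatch.not_decidableProblem_of_reduction hdom hsys.to_comp
      (fun n => (hwf n).sys_valid) fun n => (hwf n).terminates_iff.trans (hM n)
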